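/- Let $k\in C_0^\infty(-1,1)$ be real-valued with $\int_{\mathbb R}k(s)\,ds=1$. For $0<\vartheta<\pi$ and $\delta>0$ put $k_\delta(s)=\frac{\vartheta}{\delta}\,k\!\left(\frac{s}{\delta}\right)$, and let $$\widehat K(\delta)=-\frac12\frac{d^2}{ds^2}-\frac{k_\delta(s)^2}{8},\qquad D(\widehat K(\delta))=H^2(\mathbb R),$$ on $L^2(\mathbb R)$. Let $\widehat K_D=-\frac12\frac{d^2}{ds^2}$ be the free operator with a Dirichlet condition at $s=0$, that is, with domain consisting of all $f\in H^2(\mathbb R\setminus\{0\})$ with $f(0^+)=f(0^-)=0$. Call $\vartheta$ resonant for $k$ if the equation $-\frac12\psi''-\frac{\vartheta^2k^2}{8}\psi=0$ on $\mathbb R$ has a bounded $C^2$ solution $\psi$ that is not identically zero (a zero-energy resonance). Then: 1. Let $\vartheta\in(0,\pi)$ be not resonant for $k$, let $\delta(\varepsilon)>0$ for $\varepsilon>0$ with $\delta(\varepsilon)\to0$ as $\varepsilon\to0^+$, and let $\Im z>0$. Then $z^2$ lies in the resolvent set of $\widehat K_D$ and, for all sufficiently small $\varepsilon>0$, in that of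 $\widehat K(\delta(\varepsilon))$, and $$[\widehat K(\delta(\varepsilon))-z^2]^{-1}\longrightarrow[\widehat K_D-z^2]^{-1}\qquad(\varepsilon\to0^+)$$ in the norm of bounded operators on $L^2(\mathbb R)$. 2. Only finitely many $\vartheta\in(0,\pi)$ are resonant for $k$. 3. If $|k|\le1$ everywhere and $k(s)=0$ for $|s|>\frac34$, then no $\vartheta\in(0,\pi)$ is resonant for $k$, so that the convergence in 1 holds for every $\vartheta\in(0,\pi)$. -/

import Mathlib

open MeasureTheory Set Filter Topology
open scoped ContDiff ENNReal

namespace SoftGraph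

/-- The complex Hilbert space `L²(ℝ)` (Lebesgue measure). -/
abbrev L2 : Type := Lp ℂ 2 (volume : Measure ℝ)

/-! ### Weak derivatives and Sobolev spaces -/

/-- `g` is the weak derivative of `f` on the open set `Ω`: `∫ φ' f = - ∫ φ g` for all test
functions `φ ∈ C₀^∞(Ω)`.  It is used for `Ω = ℝ` and `Ω = ℝ \ {0}`, for which
`L²(Ω) = L²(ℝ)`. -/
def IsWeakDeriv (Ω : Set ℝ) (f g : L2) : Prop :=
  ∀ φ : ℝ → ℝ, ContDiff ℝ ∞ φ → HasCompactSupport φ → tsupport φ ⊆ Ω →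
    ∫ x, deriv φ x • f x = - ∫ x, φ x • g x

theorem integrable_test_smul {φ : ℝ → ℝ} (hφ : Continuous φ) (hc : HasCompactSupport φ)
    (f : L2) : Integrable (fun x => φ x • f x) :=
  ((Lp.memLp f).locallyIntegrable (by norm_num)).integrable_smul_left_of_hasCompactSupport hφ hc

theorem IsWeakDeriv.add {Ω : Set ℝ} {f g f' g' : L2} (h : IsWeakDeriv Ω f g)
    (h' : IsWeakDeriv Ω f' g') : IsWeakDeriv Ω (f + f') (g + g') := by
  intro φ hφ hc hs
  have hd : Continuous (deriv φ) := hφ.continuous_deriv (by simp)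
  have e1 : (∫ x, deriv φ x • (f + f' : L2) x) =
      ∫ x, (deriv φ x • f x + deriv φ x • f' x) := by
    apply integral_congr_ae
    filter_upwards [Lp.coeFn_add f f'] with x hx
    rw [hx, Pi.add_apply, smul_add]
  have e2 : (∫ x, φ x • (g + g' : L2) x) = ∫ x, (φ x • g x + φ x • g' x) := by
    apply integral_congr_ae
    filter_upwards [Lp.coeFn_add g g'] with x hx
    rw [hx, Pi.add_apply, smul_add]
  rw [e1, e2, integral_add (integrable_test_smul hd hc.deriv f)
    (integrable_test_smul hd hc.deriv f'), integral_add
    (integrable_test_smul hφ.continuous hc g) (integrable_test_smul hφ.continuous hc g'),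
    h φ hφ hc hs, h' φ hφ hc hs, neg_add]

theorem IsWeakDeriv.smul {Ω : Set ℝ} {f g : L2} (c : ℂ) (h : IsWeakDeriv Ω f g) :
    IsWeakDeriv Ω (c • f) (c • g) := by
  intro φ hφ hc hs
  have e1 : (∫ x, deriv φ x • (c • f : L2) x) = ∫ x, c • (deriv φ x • f x) := by
    apply integral_congr_ae
    filter_upwards [Lp.coeFn_smul c f] with x hx
    rw [hx, Pi.smul_apply, smul_comm]
  have e2 : (∫ x, φ x • (c • g : L2) x) = ∫ x, c • (φ x • g x) := by
    apply integral_congr_ae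
    filter_upwards [Lp.coeFn_smul c g] with x hx
    rw [hx, Pi.smul_apply, smul_comm]
  rw [e1, e2, integral_smul, integral_smul, h φ hφ hc hs, smul_neg]

theorem IsWeakDeriv.zero (Ω : Set ℝ) : IsWeakDeriv Ω 0 0 := by
  intro φ hφ hc hs
  have e (ψ : ℝ → ℝ) : (∫ x, ψ x • (0 : L2) x) = 0 := by
    rw [← integral_zero ℝ ℂ]
    apply integral_congr_ae
    filter_upwards [Lp.coeFn_zero ℂ 2 (volume : Measure ℝ)] with x _
    simp
  rw [e, e, neg_zero]

theorem IsWeakDeriv.unique {Ω : Set ℝ} (hΩ : IsOpen Ω) (h0 : volume Ωᶜ = 0) {f g g' : L2}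
    (h : IsWeakDeriv Ω f g) (h' : IsWeakDeriv Ω f g') : g = g' := by
  have key : ∀ᵐ x ∂(volume : Measure ℝ), x ∈ Ω → (g x - g' x) = 0 := by
    apply hΩ.ae_eq_zero_of_integral_contDiff_smul_eq_zero
    · exact (((Lp.memLp g).locallyIntegrable (by norm_num)).sub
        ((Lp.memLp g').locallyIntegrable (by norm_num))).locallyIntegrableOn Ω
    · intro φ hφ hc hs
      have a := h φ hφ hc hs
      have b := h' φ hφ hc hs
      simp only [smul_sub]
      rw [integral_sub (integrable_test_smul hφ.continuous hc g)
        (integrable_test_smul hφ.continuous hc g'), sub_eq_zero]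
      exact neg_injective (a.symm.trans b)
  have hm : ∀ᵐ x ∂(volume : Measure ℝ), x ∈ Ω := by
    rw [ae_iff]
    exact h0
  apply Lp.ext
  filter_upwards [key, hm] with x hx hx'
  exact sub_eq_zero.1 (hx hx')

/-- The Sobolev space `H²(Ω)` of the functions in `L²` that have two weak derivatives in
`L²`. -/
def sobolevH2 (Ω : Set ℝ) : Submodule ℂ L2 where
  carrier := {f | ∃ g h : L2, IsWeakDeriv Ω f g ∧ IsWeakDeriv Ω g h}
  add_mem' := by
    rintro f f' ⟨g, h, hg, hh⟩ ⟨g', h', hg', hh'⟩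
    exact ⟨g + g', h + h', hg.add hg', hh.add hh'⟩
  zero_mem' := ⟨0, 0, IsWeakDeriv.zero Ω, IsWeakDeriv.zero Ω⟩
  smul_mem' := by
    rintro c f ⟨g, h, hg, hh⟩
    exact ⟨c • g, c • h, hg.smul c, hh.smul c⟩

theorem exists_second (Ω : Set ℝ) (f : sobolevH2 Ω) :
    ∃ h : L2, ∃ g : L2, IsWeakDeriv Ω f g ∧ IsWeakDeriv Ω g h := by
  obtain ⟨g, h, a⟩ := f.2
  exact ⟨h, g, a⟩

theorem second_unique {Ω : Set ℝ} (hΩ : IsOpen Ω) (h0 : volume Ωᶜ = 0) {f h h' : L2}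
    (a : ∃ g : L2, IsWeakDeriv Ω f g ∧ IsWeakDeriv Ω g h)
    (a' : ∃ g : L2, IsWeakDeriv Ω f g ∧ IsWeakDeriv Ω g h') : h = h' := by
  obtain ⟨g, hg, hh⟩ := a
  obtain ⟨g', hg', hh'⟩ := a'
  obtain rfl := hg.unique hΩ h0 hg'
  exact hh.unique hΩ h0 hh'

/-- The second weak derivative `f ↦ f''` on `H²(Ω)`, where `Ω` is open and its complement
is a null set. -/
noncomputable def secondDeriv (Ω : Set ℝ) (hΩ : IsOpen Ω) (h0 : volume Ωᶜ = 0) :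
    sobolevH2 Ω →ₗ[ℂ] L2 where
  toFun f := (exists_second Ω f).choose
  map_add' f f' := by
    obtain ⟨g, hg, hh⟩ := (exists_second Ω f).choose_spec
    obtain ⟨g', hg', hh'⟩ := (exists_second Ω f').choose_spec
    exact second_unique hΩ h0 (exists_second Ω (f + f')).choose_spec
      ⟨g + g', hg.add hg', hh.add hh'⟩
  map_smul' c f := by
    obtain ⟨g, hg, hh⟩ := (exists_second Ω f).choose_spec
    exact second_unique hΩ h0 (exists_second Ω (c • f)).choose_spec
      ⟨c • g, hg.smul c, hh.smul c⟩

/-! ### The operators -/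

/-- Multiplication by an essentially bounded real function on `L²(ℝ)`. -/
noncomputable def mulL2 (V : ℝ → ℝ) (hV : MemLp V ∞ (volume : Measure ℝ)) : L2 →ₗ[ℂ] L2 where
  toFun f := ((Lp.memLp f).smul hV : MemLp (V • (f : ℝ → ℂ)) 2 volume).toLp _
  map_add' f f' := by
    apply Lp.ext
    filter_upwards [MemLp.coeFn_toLp
        ((Lp.memLp (f + f')).smul hV : MemLp (V • ((f + f' : L2) : ℝ → ℂ)) 2 volume),
      MemLp.coeFn_toLp ((Lp.memLp f).smul hV : MemLp (V • (f : ℝ → ℂ)) 2 volume),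
      MemLp.coeFn_toLp ((Lp.memLp f').smul hV : MemLp (V • (f' : ℝ → ℂ)) 2 volume),
      Lp.coeFn_add f f', Lp.coeFn_add
        (((Lp.memLp f).smul hV : MemLp (V • (f : ℝ → ℂ)) 2 volume).toLp _)
        (((Lp.memLp f').smul hV : MemLp (V • (f' : ℝ → ℂ)) 2 volume).toLp _)]
      with x h1 h2 h3 h4 h5
    rw [h1, h5, Pi.add_apply, h2, h3]
    simp only [Pi.smul_apply', h4, Pi.add_apply, smul_add]
  map_smul' c f := by
    apply Lp.ext
    filter_upwards [MemLp.coeFn_toLp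
        ((Lp.memLp (c • f)).smul hV : MemLp (V • ((c • f : L2) : ℝ → ℂ)) 2 volume),
      MemLp.coeFn_toLp ((Lp.memLp f).smul hV : MemLp (V • (f : ℝ → ℂ)) 2 volume),
      Lp.coeFn_smul c f, Lp.coeFn_smul c
        (((Lp.memLp f).smul hV : MemLp (V • (f : ℝ → ℂ)) 2 volume).toLp _)]
      with x h1 h2 h3 h4
    rw [h1, RingHom.id_apply, h4, Pi.smul_apply, h2]
    simp only [Pi.smul_apply', h3, Pi.smul_apply]
    rw [smul_comm]

/-- The Schrödinger operator `-½ d²/ds² + V` on `L²(ℝ)` with bounded potential `V` and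
domain `H²(ℝ)`. -/
noncomputable def schrodinger (V : ℝ → ℝ) (hV : MemLp V ∞ (volume : Measure ℝ)) :
    L2 →ₗ.[ℂ] L2 where
  domain := sobolevH2 univ
  toFun := (-(1 / 2) : ℂ) • secondDeriv univ isOpen_univ (by simp)
    + (mulL2 V hV).comp (sobolevH2 univ).subtype

/-- Domain of the Dirichlet operator: the functions in `H²(ℝ \ {0})` that are continuous on
the whole line and vanish at `0` (that is, both one-sided traces at `0` are zero). -/
def dirichletDomain : Submodule ℂ L2 where
  carrier := {f | f ∈ sobolevH2 {0}ᶜ ∧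
    ∃ F : ℝ → ℂ, Continuous F ∧ F 0 = 0 ∧ (f : ℝ → ℂ) =ᵐ[volume] F}
  add_mem' := by
    rintro f f' ⟨h, F, hF, hF0, hfF⟩ ⟨h', F', hF', hF0', hfF'⟩
    refine ⟨add_mem h h', F + F', hF.add hF', by simp [hF0, hF0'], ?_⟩
    exact (Lp.coeFn_add f f').trans (hfF.add hfF')
  zero_mem' := ⟨zero_mem _, 0, continuous_zero, rfl, Lp.coeFn_zero ℂ 2 volume⟩
  smul_mem' := by
    rintro c f ⟨h, F, hF, hF0, hfF⟩
    refine ⟨Submodule.smul_mem _ c h, c • F, hF.const_smul c, by simp [hF0], ?_⟩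
    exact (Lp.coeFn_smul c f).trans (hfF.const_smul c)

theorem dirichletDomain_le : dirichletDomain ≤ sobolevH2 {0}ᶜ := fun _ h => h.1

/-- The free operator `-½ d²/ds²` on `L²(ℝ)` with a Dirichlet condition at `s = 0`. -/
noncomputable def dirichletOp : L2 →ₗ.[ℂ] L2 where
  domain := dirichletDomain
  toFun := (-(1 / 2) : ℂ) •
    (secondDeriv {0}ᶜ isOpen_compl_singleton (by simp)).comp
      (Submodule.inclusion dirichletDomain_le)

/-! ### Resolvents of unbounded operators -/

/-- The bounded operator `R` is a two-sided inverse of `A - w : D(A) → L²(ℝ)`. -/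
def IsResolventAt (A : L2 →ₗ.[ℂ] L2) (w : ℂ) (R : L2 →L[ℂ] L2) : Prop :=
  (∀ f : L2, ∃ h : R f ∈ A.domain, A ⟨R f, h⟩ - w • R f = f) ∧
    ∀ u : A.domain, R (A u - w • (u : L2)) = u

/-- The resolvent set of `A`. -/
def opResolventSet (A : L2 →ₗ.[ℂ] L2) : Set ℂ := {w | ∃ R : L2 →L[ℂ] L2, IsResolventAt A w R}

theorem IsResolventAt.unique {A : L2 →ₗ.[ℂ] L2} {w : ℂ} {R R' : L2 →L[ℂ] L2}
    (h : IsResolventAt A w R) (h' : IsResolventAt A w R') : R = R' := by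
  ext1 f
  obtain ⟨hm, e⟩ := h.1 f
  have := h'.2 ⟨R f, hm⟩
  rw [e] at this
  exact this.symm

open Classical in
/-- The resolvent `(A - w)⁻¹`, a bounded operator, for `w` in the resolvent set of `A`
(and `0` for other `w`). -/
noncomputable def opResolvent (A : L2 →ₗ.[ℂ] L2) (w : ℂ) : L2 →L[ℂ] L2 :=
  if h : w ∈ opResolventSet A then h.choose else 0

theorem opResolvent_eq {A : L2 →ₗ.[ℂ] L2} {w : ℂ} {R : L2 →L[ℂ] L2}
    (h : IsResolventAt A w R) : opResolvent A w = R := by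
  have hw : w ∈ opResolventSet A := ⟨R, h⟩
  rw [opResolvent, dif_pos hw]
  exact hw.choose_spec.unique h

/-! ### The rescaled curvature -/

/-- A curvature profile: a real `k ∈ C₀^∞(-1, 1)` with `∫ k = 1`. -/
structure CurvatureProfile where
  k : ℝ → ℝ
  smooth : ContDiff ℝ ∞ k
  supp : tsupport k ⊆ Ioo (-1) 1
  integral_eq : ∫ s, k s = 1

/-- The curvature `k_δ(s) = (ϑ / δ) k(s / δ)`. -/
noncomputable def CurvatureProfile.scaled (p : CurvatureProfile) (ϑ δ : ℝ) (s : ℝ) : ℝ :=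
  ϑ / δ * p.k (s / δ)

theorem CurvatureProfile.hasCompactSupport (p : CurvatureProfile) : HasCompactSupport p.k :=
  isCompact_Icc.of_isClosed_subset (isClosed_tsupport _) (p.supp.trans Ioo_subset_Icc_self)

theorem CurvatureProfile.memLp_potential (p : CurvatureProfile) (ϑ δ : ℝ) :
    MemLp (fun s => -(p.scaled ϑ δ s) ^ 2 / 8) ∞ (volume : Measure ℝ) := by
  obtain ⟨C, hC⟩ := p.hasCompactSupport.exists_bound_of_continuous p.smooth.continuous
  have hc : Continuous (fun s => -(p.scaled ϑ δ s) ^ 2 / 8) := by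
    have := p.smooth.continuous
    unfold CurvatureProfile.scaled
    fun_prop
  refine memLp_top_of_bound hc.aestronglyMeasurable ((|ϑ / δ| * C) ^ 2 / 8)
    (Eventually.of_forall fun s => ?_)
  have h1 : |p.scaled ϑ δ s| ≤ |ϑ / δ| * C := by
    rw [CurvatureProfile.scaled, abs_mul]
    exact mul_le_mul_of_nonneg_left (hC _) (abs_nonneg _)
  rw [Real.norm_eq_abs, abs_div, abs_neg, abs_pow]
  have h2 : |p.scaled ϑ δ s| ^ 2 ≤ (|ϑ / δ| * C) ^ 2 :=
    pow_le_pow_left₀ (abs_nonneg _) h1 2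
  rw [show |(8 : ℝ)| = 8 by norm_num]
  exact div_le_div_of_nonneg_right h2 (by norm_num)

/-- The operator `K(δ) = -½ d²/ds² - k_δ(s)² / 8` with domain `H²(ℝ)`. -/
noncomputable def curvatureOp (p : CurvatureProfile) (ϑ δ : ℝ) : L2 →ₗ.[ℂ] L2 :=
  schrodinger (fun s => -(p.scaled ϑ δ s) ^ 2 / 8) (p.memLp_potential ϑ δ)

/-- Zero-energy resonance of `K(1) = -½ d²/ds² - ϑ² k² / 8`: a bounded classical solution
`ψ`, not identically zero, of `-½ ψ'' - (ϑ² k² / 8) ψ = 0` on `ℝ`. -/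
def ZeroEnergyResonance (p : CurvatureProfile) (ϑ : ℝ) : Prop :=
  ∃ ψ : ℝ → ℝ, ContDiff ℝ 2 ψ ∧ (∃ s, ψ s ≠ 0) ∧ (∃ C, ∀ s, |ψ s| ≤ C) ∧
    ∀ s, -(1 / 2) * deriv (deriv ψ) s - ϑ ^ 2 * p.k s ^ 2 / 8 * ψ s = 0

end SoftGraph

namespace SoftGraph

/-! Put $\kappa=\sqrt2\,z$, so $\Im\kappa>0$. The equation $(\widehat K(\delta)-z^2)u=f$ becomes
$u''+\kappa^2u+\frac{\vartheta^2}{4\delta^2}k(x/\delta)^2u=-2f$. The heart of the proof is the a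
priori bound $\sup_{[-\delta,\delta]}|u|=O(\delta\|f\|)$ in `exists_apriori`. For $|x|\ge\delta$ the
potential vanishes, and pairing with the decaying exponential gives $|u'(\pm\delta)|\le C(M+\|f\|)$
with $M=\sup_{[-\delta,\delta]}|u|$ (`norm_deriv_sub_le`). On $[-\delta,\delta]$ one forms the
Wronskians of $u$ with the rescaled zero-energy solutions $P(x/\delta)$, $Q(x/\delta)$, where $P=1$
to the right and $Q=1$ to the left of the support of $k$. The singular potential cancels, so both
Wronskians stay $O(M+\|f\|)$ (`norm_wronskian_le`). Eliminating $u'$ gives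
$u\,\rho/\delta=O(M+\|f\|)$, where $\rho$ is the Wronskian of $P$ and $Q$. It is nonzero when there
is no resonance (`exists_independent_sols`). For small $\delta$ the term in $M$ is absorbed.

The Dirichlet solution with the same $f$ vanishes at $0$ and is Hölder-1/2, hence
$O(\sqrt\delta\|f\|)$ on $[-\delta,\delta]$. Outside, the difference of the two solutions satisfies
the homogeneous equation and is a decaying exponential on each side. So the difference has norm
$O(\sqrt\delta\|f\|)$ in $L^2$ (`exists_comparison`). The same estimate bounds $\widehat
K(\delta)-z^2$ from below; used at $-\bar\kappa$ it gives dense range, and so the resolvent exists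
(`schrodinger_exists_resolvent`).

Finiteness: with $l=\vartheta^2/4$, a resonance makes the solution $W_l$ equal to $1$ on the right
satisfy the Neumann condition at $-1$ too. Two such solutions with different $l$ are orthogonal for
the weight $k^2$. Since $\int k^2W_lW_m$ is continuous in $(l,m)$ and positive for $l=m$, nearby
angles cannot both be resonant; compactness concludes (`finite_resonances`).

For small $k$, a bounded solution is Neumann at both ends of an interval containing the support. If
it has no zero there, integrating the equation gives a contradiction; if it has one, a
Dirichlet–Neumann interval too short for a nonzero solution appears (`not_resonance`). -/

theorem intervalIntegrable_of_locallyIntegrable {E : Type*} [NormedAddCommGroup E] {f : ℝ → E}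
    (hf : LocallyIntegrable f) (a b : ℝ) : IntervalIntegrable f volume a b :=
  intervalIntegrable_iff.mpr
    ((hf.integrableOn_isCompact isCompact_uIcc).mono_set uIoc_subset_uIcc)

/-! ### Locally absolutely continuous functions, handled as primitives -/

section Primitive

variable {E E' : Type*} [NormedAddCommGroup E] [NormedSpace ℝ E] [NormedAddCommGroup E']
  [NormedSpace ℝ E']

/-- `F` is a primitive of the locally integrable function `f`. -/
structure IsPrimitive (F f : ℝ → E) : Prop where
  locallyIntegrable : LocallyIntegrable f
  sub_eq : ∀ a b, F b - F a = ∫ x in a..b, f x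

namespace IsPrimitive

variable {F f G g : ℝ → E}

theorem intervalIntegrable (h : IsPrimitive F f) (a b : ℝ) : IntervalIntegrable f volume a b :=
  intervalIntegrable_of_locallyIntegrable h.locallyIntegrable a b

theorem eq_add (h : IsPrimitive F f) (a : ℝ) : F = fun x => F a + ∫ t in a..x, f t := by
  ext x
  rw [← h.sub_eq, add_sub_cancel]

theorem of_locallyIntegrable [CompleteSpace E] (hf : LocallyIntegrable f) (c : E) (a : ℝ) :
    IsPrimitive (fun x => c + ∫ t in a..x, f t) f := by
  refine ⟨hf, fun x y => ?_⟩
  rw [add_sub_add_left_eq_sub, intervalIntegral.integral_interval_sub_left] <;>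
    exact intervalIntegrable_of_locallyIntegrable hf _ _

theorem continuous (h : IsPrimitive F f) : Continuous F := by
  rw [h.eq_add 0]
  exact continuous_const.add
    (intervalIntegral.continuous_primitive (fun a b => h.intervalIntegrable a b) 0)

theorem of_hasDerivAt [CompleteSpace E] (h : ∀ x, HasDerivAt F (f x) x) (hf : Continuous f) :
    IsPrimitive F f :=
  ⟨hf.locallyIntegrable, fun a b => (intervalIntegral.integral_eq_sub_of_hasDerivAt
    (fun x _ => h x) (hf.intervalIntegrable a b)).symm⟩

theorem congr_ae (h : IsPrimitive F f) (hfg : f =ᵐ[volume] g) : IsPrimitive F g :=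
  ⟨h.locallyIntegrable.congr hfg, fun a b => by
    rw [h.sub_eq, intervalIntegral.integral_congr_ae]
    filter_upwards [hfg] with x hx _ using hx⟩

theorem add (h : IsPrimitive F f) (h' : IsPrimitive G g) :
    IsPrimitive (fun x => F x + G x) (fun x => f x + g x) :=
  ⟨h.locallyIntegrable.add h'.locallyIntegrable, fun a b => by
    rw [intervalIntegral.integral_add (h.intervalIntegrable a b) (h'.intervalIntegrable a b),
      ← h.sub_eq, ← h'.sub_eq]
    abel⟩

theorem clm [CompleteSpace E] [CompleteSpace E'] (h : IsPrimitive F f) (L : E →L[ℝ] E') :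
    IsPrimitive (fun x => L (F x)) (fun x => L (f x)) := by
  refine ⟨fun x => ?_, fun a b => ?_⟩
  · obtain ⟨s, hs, hi⟩ := h.locallyIntegrable x
    exact ⟨s, hs, L.integrable_comp hi⟩
  · rw [L.intervalIntegral_comp_comm (h.intervalIntegrable a b), ← h.sub_eq, map_sub]

theorem neg [CompleteSpace E] (h : IsPrimitive F f) :
    IsPrimitive (fun x => -F x) (fun x => -f x) :=
  h.clm (-ContinuousLinearMap.id ℝ E)

theorem sub [CompleteSpace E] (h : IsPrimitive F f) (h' : IsPrimitive G g) :
    IsPrimitive (fun x => F x - G x) (fun x => f x - g x) := by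
  simpa only [sub_eq_add_neg] using h.add h'.neg

theorem comp_neg (h : IsPrimitive F f) : IsPrimitive (fun x => F (-x)) (fun x => -f (-x)) := by
  have hl : LocallyIntegrable (fun x => f (-x)) := by
    rw [locallyIntegrable_iff]
    intro k hk
    have := (locallyIntegrable_iff.1 h.locallyIntegrable (-k) hk.neg)
    have e := (Measure.measurePreserving_neg (volume : Measure ℝ)).integrableOn_comp_preimage
      (Homeomorph.neg ℝ).measurableEmbedding (f := f) (s := -k)
    have : IntegrableOn (f ∘ Neg.neg) (Neg.neg ⁻¹' (-k)) := e.2 this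
    simpa [Set.neg_preimage, Function.comp_def] using this
  refine ⟨hl.neg, fun a b => ?_⟩
  rw [intervalIntegral.integral_neg, intervalIntegral.integral_comp_neg, h.sub_eq,
    intervalIntegral.integral_symm]

theorem absolutelyContinuous {F f : ℝ → ℝ} (h : IsPrimitive F f) (a b : ℝ) :
    AbsolutelyContinuousOnInterval F a b ∧ ∀ᵐ x, HasDerivAt F (f x) x := by
  constructor
  · rw [h.eq_add a]
    refine AbsolutelyContinuousOnInterval.add (f := fun _ => F a) ?_
      ((h.intervalIntegrable a b).absolutelyContinuousOnInterval_intervalIntegral (by simp))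
    exact (LipschitzWith.const (F a)).lipschitzOnWith.absolutelyContinuousOnInterval
  · filter_upwards [LocallyIntegrable.ae_hasDerivAt_integral h.locallyIntegrable] with x hx
    rw [h.eq_add a]
    simpa using (hx a).const_add (F a)

theorem locallyIntegrable_mul {R : Type*} [NormedRing R] [NormedSpace ℝ R] {F f g : ℝ → R}
    (h : IsPrimitive F f) (hg : LocallyIntegrable g) : LocallyIntegrable (fun x => F x * g x) := by
  rw [locallyIntegrable_iff] at *
  exact fun k hk => (hg k hk).continuousOn_mul h.continuous.continuousOn hk

theorem locallyIntegrable_mul' {R : Type*} [NormedRing R] [NormedSpace ℝ R] {F f g : ℝ → R}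
    (h : IsPrimitive F f) (hg : LocallyIntegrable g) : LocallyIntegrable (fun x => g x * F x) := by
  rw [locallyIntegrable_iff] at *
  exact fun k hk => (hg k hk).mul_continuousOn h.continuous.continuousOn hk

/-- The product rule holds almost everywhere, and absolute continuity lets it be integrated. All
later integrations by parts and Wronskian identities rest on this. -/
theorem mul_real {F f G g : ℝ → ℝ} (h : IsPrimitive F f) (h' : IsPrimitive G g) :
    IsPrimitive (fun x => F x * G x) (fun x => f x * G x + F x * g x) := by
  refine ⟨(h'.locallyIntegrable_mul' h.locallyIntegrable).add
    (h.locallyIntegrable_mul h'.locallyIntegrable), fun a b => ?_⟩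
  rw [← (h.absolutelyContinuous a b).1.integral_deriv_mul_eq_sub (h'.absolutelyContinuous a b).1]
  apply intervalIntegral.integral_congr_ae
  filter_upwards [(h.absolutelyContinuous a b).2, (h'.absolutelyContinuous a b).2] with x h1 h2 _
  rw [h1.deriv, h2.deriv]

theorem mul {F f G g : ℝ → ℂ} (h : IsPrimitive F f) (h' : IsPrimitive G g) :
    IsPrimitive (fun x => F x * G x) (fun x => f x * G x + F x * g x) := by
  have r := h.clm Complex.reCLM
  have i := h.clm Complex.imCLM
  have r' := h'.clm Complex.reCLM
  have i' := h'.clm Complex.imCLM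
  have re := ((r.mul_real r').sub (i.mul_real i')).clm Complex.ofRealCLM
  have im := ((r.mul_real i').add (i.mul_real r')).clm Complex.ofRealCLM
  have := re.add (im.clm (ContinuousLinearMap.mul ℝ ℂ Complex.I))
  convert this using 2 <;> apply Complex.ext <;> simp <;> ring

theorem const_mul {F f : ℝ → ℂ} (h : IsPrimitive F f) (c : ℂ) :
    IsPrimitive (fun x => c * F x) (fun x => c * f x) :=
  h.clm (ContinuousLinearMap.mul ℝ ℂ c)

theorem conj {F f : ℝ → ℂ} (h : IsPrimitive F f) :
    IsPrimitive (fun x => starRingEnd ℂ (F x)) (fun x => starRingEnd ℂ (f x)) :=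
  h.clm (Complex.conjCLE : ℂ →L[ℝ] ℂ)

/-- An integrable function with integrable derivative on a half-line vanishes at infinity. -/
theorem integral_Ioi [CompleteSpace E] (h : IsPrimitive F f) {c : ℝ} (hF : IntegrableOn F (Ioi c))
    (hf : IntegrableOn f (Ioi c)) : ∫ x in Ioi c, f x = -F c := by
  have ht : Tendsto F atTop (𝓝 (F c + ∫ x in Ioi c, f x)) := by
    rw [h.eq_add c]
    simpa using (intervalIntegral_tendsto_integral_Ioi c hf tendsto_id).const_add (F c)
  have h0 : F c + ∫ x in Ioi c, f x = 0 := by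
    -- `F` converges because `f` is integrable; an integrable function can only converge to zero.
    apply IntegrableAtFilter.eq_zero_of_tendsto ⟨Ioi c, Ioi_mem_atTop c, hF⟩ _ ht
    intro s hs
    obtain ⟨b, hb⟩ := mem_atTop_sets.1 hs
    rw [← top_le_iff, ← Real.volume_Ici (a := b)]
    exact measure_mono hb
  exact (neg_eq_of_add_eq_zero_right h0).symm

theorem integral_eq_zero [CompleteSpace E] (h : IsPrimitive F f) (hF : Integrable F)
    (hf : Integrable f) : ∫ x, f x = 0 := by
  have h1 := h.integral_Ioi (c := 0) hF.integrableOn hf.integrableOn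
  have h2 := h.comp_neg.integral_Ioi (c := 0) hF.comp_neg.integrableOn
    hf.comp_neg.neg.integrableOn
  rw [integral_neg, integral_comp_neg_Ioi] at h2
  rw [← setIntegral_univ, ← Iic_union_Ioi (a := (0 : ℝ)), setIntegral_union
    (Iic_disjoint_Ioi le_rfl) measurableSet_Ioi hf.integrableOn hf.integrableOn, h1]
  rw [neg_zero, neg_inj] at h2
  rw [h2, add_neg_cancel]

end IsPrimitive

end Primitive

/-! ### Weak derivatives and their absolutely continuous representatives -/

theorem locallyIntegrable_coe (f : L2) : LocallyIntegrable (f : ℝ → ℂ) :=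
  (Lp.memLp f).locallyIntegrable (by norm_num)

theorem isPrimitive_ofReal {φ : ℝ → ℝ} (hφ : ContDiff ℝ 1 φ) :
    IsPrimitive (fun x => (φ x : ℂ)) (fun x => ((deriv φ x : ℝ) : ℂ)) := by
  have : IsPrimitive φ (deriv φ) := IsPrimitive.of_hasDerivAt
    (fun x => (hφ.differentiable (by simp) x).hasDerivAt) (hφ.continuous_deriv (by simp))
  exact this.clm Complex.ofRealCLM

theorem IsPrimitive.integral_deriv_smul {F f : ℝ → ℂ} (h : IsPrimitive F f) {φ : ℝ → ℝ}
    (hφ : ContDiff ℝ 1 φ) (hc : HasCompactSupport φ) :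
    ∫ x, deriv φ x • F x = -∫ x, φ x • f x := by
  have hd : Continuous (deriv φ) := hφ.continuous_deriv (by simp)
  have i1 : Integrable (fun x => deriv φ x • F x) :=
    h.continuous.locallyIntegrable.integrable_smul_left_of_hasCompactSupport hd hc.deriv
  have i2 : Integrable (fun x => φ x • f x) :=
    h.locallyIntegrable.integrable_smul_left_of_hasCompactSupport hφ.continuous hc
  have i3 : Integrable (fun x => φ x • F x) :=
    h.continuous.locallyIntegrable.integrable_smul_left_of_hasCompactSupport hφ.continuous hc
  have := ((isPrimitive_ofReal hφ).mul h).integral_eq_zero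
    (by simpa using i3) (by simp only [← Complex.real_smul]; exact i1.add i2)
  rw [integral_add (by simpa using i1) (by simpa using i2)] at this
  simp only [Complex.real_smul]
  exact eq_neg_of_add_eq_zero_left this

theorem IsPrimitive.isWeakDeriv {F : ℝ → ℂ} {f g : L2} (h : IsPrimitive F g)
    (hf : (f : ℝ → ℂ) =ᵐ[volume] F) (Ω : Set ℝ) : IsWeakDeriv Ω f g := by
  intro φ hφ hc _
  rw [← h.integral_deriv_smul (hφ.of_le (by simp)) hc]
  apply integral_congr_ae
  filter_upwards [hf] with x hx
  rw [hx]

/-- A locally integrable function with zero weak derivative on an interval is constant. -/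
theorem exists_ae_eq_const {I : Set ℝ} (hI : IsOpen I) (hO : I.OrdConnected) (hne : I.Nonempty)
    {r : ℝ → ℂ} (hr : LocallyIntegrable r)
    (h : ∀ φ : ℝ → ℝ, ContDiff ℝ ∞ φ → HasCompactSupport φ → tsupport φ ⊆ I →
      ∫ x, deriv φ x • r x = 0) : ∃ c : ℂ, ∀ᵐ x, x ∈ I → r x = c := by
  obtain ⟨x₀, hx₀⟩ := hne
  obtain ⟨ε, hε, hball⟩ := Metric.nhds_basis_closedBall.mem_iff.1 (hI.mem_nhds hx₀)
  let B : ContDiffBump x₀ := ⟨ε / 2, ε, by positivity, by linarith⟩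
  have hρ : ContDiff ℝ ∞ (B.normed volume) := B.contDiff_normed
  have hρc : HasCompactSupport (B.normed volume) := B.hasCompactSupport_normed
  have hρI : tsupport (B.normed volume) ⊆ I := by
    rw [B.tsupport_normed_eq]; exact hball
  have hρ1 : ∫ x, B.normed volume x = 1 := B.integral_normed
  generalize B.normed volume = ρ at hρ hρc hρI hρ1
  have hint : ∀ {φ : ℝ → ℝ}, ContDiff ℝ ∞ φ → HasCompactSupport φ →
      Integrable (fun x => φ x • r x) := fun hφ hc =>
    hr.integrable_smul_left_of_hasCompactSupport hφ.continuous hc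
  refine ⟨∫ x, ρ x • r x, ?_⟩
  have key : ∀ᵐ x, x ∈ I → r x - (∫ x, ρ x • r x) = 0 := by
    apply hI.ae_eq_zero_of_integral_contDiff_smul_eq_zero
    · exact (hr.sub (locallyIntegrable_const _)).locallyIntegrableOn I
    intro φ hφ hc hs
    set m := ∫ x, φ x with hm
    have hiφ : Integrable φ := hφ.continuous.integrable_of_hasCompactSupport hc
    have hiρ : Integrable ρ := hρ.continuous.integrable_of_hasCompactSupport hρc
    -- Subtracting the multiple `m` of the unit-mass bump `ρ` leaves mean zero, so the primitive of
    -- `ψ` has compact support and is an admissible test function.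
    set ψ : ℝ → ℝ := fun x => φ x - m * ρ x with hψ
    have hψs : ContDiff ℝ ∞ ψ := hφ.sub (contDiff_const.mul hρ)
    have hψ0 : ∫ x, ψ x = 0 := by
      rw [integral_sub hiφ (hiρ.const_mul m), integral_const_mul, hρ1, mul_one, ← hm, sub_self]
    have hK : IsCompact (tsupport φ ∪ tsupport ρ) := hc.isCompact.union hρc.isCompact
    have hKI : tsupport φ ∪ tsupport ρ ⊆ I := union_subset hs hρI
    have hKne : (tsupport φ ∪ tsupport ρ).Nonempty := by
      by_contra hcon
      rw [not_nonempty_iff_eq_empty, union_empty_iff] at hcon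
      have : ρ = 0 := tsupport_eq_empty_iff.1 hcon.2
      simp [this] at hρ1
    obtain ⟨a, haK, ha⟩ := hK.exists_isLeast hKne
    obtain ⟨b, hbK, hb⟩ := hK.exists_isGreatest hKne
    -- The base point `a'` lies in `I` strictly to the left of both supports, so that `ψ` lives on
    -- the half-open interval `Ioc a' b`.
    obtain ⟨l, hl, hlI⟩ := exists_Ioc_subset_of_mem_nhds (hI.mem_nhds (hKI haK)) (exists_lt a)
    obtain ⟨a', hla', ha'a⟩ := exists_between hl
    have ha'I : a' ∈ I := hlI ⟨hla', ha'a.le⟩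
    have hsup : ∀ x, x ∉ Ioc a' b → ψ x = 0 := by
      intro x hx
      have hxK : x ∉ tsupport φ ∪ tsupport ρ := fun hxK =>
        hx ⟨ha'a.trans_le (ha hxK), hb hxK⟩
      rw [mem_union, not_or] at hxK
      simp [hψ, image_eq_zero_of_notMem_tsupport hxK.1, image_eq_zero_of_notMem_tsupport hxK.2]
    set Φ : ℝ → ℝ := fun x => ∫ t in a'..x, ψ t with hΦ
    have hΦd : ∀ x, HasDerivAt Φ (ψ x) x := fun x =>
      (hψs.continuous.integral_hasStrictDerivAt a' x).hasDerivAt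
    have hderiv : deriv Φ = ψ := funext fun x => (hΦd x).deriv
    have hΦs : ContDiff ℝ ∞ Φ := by
      rw [contDiff_infty_iff_deriv]
      exact ⟨fun x => (hΦd x).differentiableAt, hderiv ▸ hψs⟩
    have hΦsup : tsupport Φ ⊆ Icc a' b := by
      refine closure_minimal (fun x hx => ?_) isClosed_Icc
      by_contra hcon
      apply hx
      rcases lt_or_ge x a' with hxa | hxa
      · refine (intervalIntegral.integral_congr (g := fun _ => 0) fun t ht => hsup t ?_).trans
          (by simp)
        rw [uIcc_of_ge hxa.le] at ht
        exact fun h' => absurd ht.2 (not_le.2 h'.1)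
      · have hbx : b < x := by
          by_contra h'; exact hcon ⟨hxa, not_lt.1 h'⟩
        rw [hΦ]
        beta_reduce
        rw [intervalIntegral.integral_eq_integral_of_support_subset, hψ0]
        intro t ht
        by_contra h'
        exact ht (hsup t fun h'' => h' ⟨h''.1, h''.2.trans hbx.le⟩)
    have hΦc : HasCompactSupport Φ := isCompact_Icc.of_isClosed_subset (isClosed_tsupport _) hΦsup
    have := h Φ hΦs hΦc (hΦsup.trans (hO.out ha'I (hKI hbK)))
    rw [hderiv] at this
    simp only [hψ, sub_smul, mul_smul] at this
    rw [integral_sub (hint hφ hc) (by exact (hint hρ hρc).smul m), integral_smul] at this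
    simp only [smul_sub]
    rw [integral_sub (hint hφ hc) (hiφ.smul_const _), integral_smul_const, ← hm, this]
  filter_upwards [key] with x hx hxI
  exact sub_eq_zero.1 (hx hxI)

/-- A function with a weak derivative has, on each interval, a primitive as representative. -/
theorem IsWeakDeriv.exists_isPrimitive {Ω I : Set ℝ} {f g : L2} (h : IsWeakDeriv Ω f g)
    (hI : IsOpen I) (hO : I.OrdConnected) (hne : I.Nonempty) (hIΩ : I ⊆ Ω) :
    ∃ F : ℝ → ℂ, IsPrimitive F g ∧ ∀ᵐ x, x ∈ I → f x = F x := by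
  have hG : IsPrimitive (fun x => 0 + ∫ t in (0 : ℝ)..x, g t) g :=
    IsPrimitive.of_locallyIntegrable (locallyIntegrable_coe g) 0 0
  obtain ⟨c, hc⟩ := exists_ae_eq_const hI hO hne
    ((locallyIntegrable_coe f).sub hG.continuous.locallyIntegrable) (by
      intro φ hφ hc hs
      simp only [Pi.sub_apply, smul_sub]
      have hd : Continuous (deriv φ) := hφ.continuous_deriv (by simp)
      rw [integral_sub (integrable_test_smul hd hc.deriv f)
        (hG.continuous.locallyIntegrable.integrable_smul_left_of_hasCompactSupport hd hc.deriv),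
        h φ hφ hc (hs.trans hIΩ), hG.integral_deriv_smul (hφ.of_le (by simp)) hc, sub_self])
  refine ⟨fun x => c + ∫ t in (0 : ℝ)..x, g t,
    IsPrimitive.of_locallyIntegrable (locallyIntegrable_coe g) c 0, ?_⟩
  filter_upwards [hc] with x hx hxI
  rw [← hx hxI]
  simp

theorem IsWeakDeriv.exists_isPrimitive_univ {f g : L2} (h : IsWeakDeriv univ f g) :
    ∃ F : ℝ → ℂ, IsPrimitive F g ∧ (f : ℝ → ℂ) =ᵐ[volume] F := by
  obtain ⟨F, hF, hf⟩ := h.exists_isPrimitive isOpen_univ ordConnected_univ univ_nonempty le_rfl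
  refine ⟨F, hF, ?_⟩
  filter_upwards [hf] with x hx using hx trivial

/-- Integration by parts in `H¹(ℝ)`. -/
theorem IsWeakDeriv.inner_add_inner {f g f' g' : L2} (h : IsWeakDeriv univ f g)
    (h' : IsWeakDeriv univ f' g') : inner ℂ g f' + inner ℂ f g' = 0 := by
  obtain ⟨F, hF, hf⟩ := h.exists_isPrimitive_univ
  obtain ⟨F', hF', hf'⟩ := h'.exists_isPrimitive_univ
  have i1 : Integrable (fun x => inner ℂ (g x) (f' x)) := L2.integrable_inner g f'
  have i2 : Integrable (fun x => inner ℂ (f x) (g' x)) := L2.integrable_inner f g'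
  have i3 : Integrable (fun x => inner ℂ (f x) (f' x)) := L2.integrable_inner f f'
  rw [L2.inner_def, L2.inner_def, ← integral_add i1 i2]
  have hm := hF.conj.mul hF'
  have e : (fun x => inner ℂ (g x) (f' x) + inner ℂ (f x) (g' x)) =ᵐ[volume]
      fun x => starRingEnd ℂ (g x) * F' x + starRingEnd ℂ (F x) * g' x := by
    filter_upwards [hf, hf'] with x hx hx'
    rw [hx, hx', RCLike.inner_apply, RCLike.inner_apply]
    ring
  rw [integral_congr_ae e]
  refine hm.integral_eq_zero (i3.congr ?_) ((i1.add i2).congr e)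
  filter_upwards [hf, hf'] with x hx hx'
  rw [hx, hx', RCLike.inner_apply]
  ring

theorem IsWeakDeriv.mono {Ω Ω' : Set ℝ} {f g : L2} (h : IsWeakDeriv Ω f g) (hs : Ω' ⊆ Ω) :
    IsWeakDeriv Ω' f g := fun φ hφ hc hφs => h φ hφ hc (hφs.trans hs)

/-! ### The free resolvent, by closed-range arguments -/

/-- A bounded operator that is bounded below and has dense range has a bounded right inverse. -/
theorem exists_rightInverse {E F : Type*} [NormedAddCommGroup E] [NormedSpace ℂ E]
    [CompleteSpace E] [NormedAddCommGroup F] [InnerProductSpace ℂ F] [CompleteSpace F]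
    (T : E →L[ℂ] F) (C : ℝ) (hb : ∀ x, ‖x‖ ≤ C * ‖T x‖)
    (hd : ∀ h, (∀ x, inner ℂ (T x) h = 0) → h = 0) : ∃ S : F →L[ℂ] E, ∀ y, T (S y) = y := by
  have ha : AntilipschitzWith (Real.toNNReal C) T := by
    refine T.antilipschitz_of_bound fun x => (hb x).trans ?_
    exact mul_le_mul_of_nonneg_right (Real.le_coe_toNNReal C) (norm_nonneg _)
  have hc : IsClosed (LinearMap.range (T : E →ₗ[ℂ] F) : Set F) := by
    exact ha.isClosed_range T.uniformContinuous
  have hker : LinearMap.ker (T : E →ₗ[ℂ] F) = ⊥ := LinearMap.ker_eq_bot.2 ha.injective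
  have hran : LinearMap.range (T : E →ₗ[ℂ] F) = ⊤ := by
    rw [← hc.submodule_topologicalClosure_eq, Submodule.topologicalClosure_eq_top_iff,
      Submodule.eq_bot_iff]
    intro h hh
    exact hd h fun x => (Submodule.mem_orthogonal _ _).1 hh _ ⟨x, rfl⟩
  refine ⟨(ContinuousLinearEquiv.ofBijective T hker hran).symm, fun y => ?_⟩
  exact ContinuousLinearEquiv.ofBijective_apply_symm_apply T hker hran y

/-- A test function as an element of `L²(ℝ)`. -/
noncomputable def testL2 (φ : ℝ → ℝ) (hφ : Continuous φ) (hc : HasCompactSupport φ) : L2 :=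
  MemLp.toLp (fun x => (φ x : ℂ)) ((Complex.continuous_ofReal.comp hφ).memLp_of_hasCompactSupport
    (hc.comp_left Complex.ofReal_zero))

theorem coe_testL2 (φ : ℝ → ℝ) (hφ : Continuous φ) (hc : HasCompactSupport φ) :
    (testL2 φ hφ hc : ℝ → ℂ) =ᵐ[volume] fun x => (φ x : ℂ) := MemLp.coeFn_toLp _

theorem inner_testL2 (φ : ℝ → ℝ) (hφ : Continuous φ) (hc : HasCompactSupport φ) (f : L2) :
    inner ℂ (testL2 φ hφ hc) f = ∫ x, φ x • f x := by
  rw [L2.inner_def]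
  apply integral_congr_ae
  filter_upwards [coe_testL2 φ hφ hc] with x hx
  rw [hx, RCLike.inner_apply, Complex.conj_ofReal, Complex.real_smul, mul_comm]

theorem isWeakDeriv_testL2 {φ : ℝ → ℝ} (hφ : ContDiff ℝ ∞ φ) (hc : HasCompactSupport φ) :
    IsWeakDeriv univ (testL2 φ hφ.continuous hc)
      (testL2 (deriv φ) (hφ.continuous_deriv (by simp)) hc.deriv) := by
  have h := isPrimitive_ofReal (hφ.of_le (by simp) : ContDiff ℝ 1 φ)
  exact (h.congr_ae (coe_testL2 (deriv φ) _ _).symm).isWeakDeriv (coe_testL2 φ _ _) univ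

/-- The graph of the weak derivative. -/
def weakDerivGraph : Submodule ℂ (L2 × L2) where
  carrier := {p | IsWeakDeriv univ p.1 p.2}
  add_mem' h h' := h.add h'
  zero_mem' := IsWeakDeriv.zero univ
  smul_mem' c _ h := h.smul c

/-- Each test function imposes one closed linear condition. Closedness makes the graph a Banach
space, on which $d/dx+\mu$ is a bounded operator. -/
theorem isClosed_weakDerivGraph : IsClosed (weakDerivGraph : Set (L2 × L2)) := by
  have : (weakDerivGraph : Set (L2 × L2)) = ⋂ (φ : ℝ → ℝ) (hφ : ContDiff ℝ ∞ φ)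
      (hc : HasCompactSupport φ), {p | inner ℂ (testL2 (deriv φ)
        (hφ.continuous_deriv (by simp)) hc.deriv) p.1 =
        - inner ℂ (testL2 φ hφ.continuous hc) p.2} := by
    ext p
    simp only [mem_iInter, mem_ofPred_eq, inner_testL2]
    exact ⟨fun h φ hφ hc => h φ hφ hc (subset_univ _), fun h φ hφ hc _ => h φ hφ hc⟩
  rw [this]
  refine isClosed_iInter fun φ => isClosed_iInter fun hφ => isClosed_iInter fun hc => ?_
  exact isClosed_eq (continuous_const.inner continuous_fst)
    (continuous_const.inner continuous_snd).neg

theorem IsWeakDeriv.re_inner_eq_zero {f g : L2} (h : IsWeakDeriv univ f g) :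
    (inner ℂ f g).re = 0 := by
  have := congrArg Complex.re (h.inner_add_inner h)
  rw [Complex.add_re, ← inner_conj_symm, Complex.conj_re, Complex.zero_re] at this
  linarith

theorem re_inner_smul_self (μ : ℂ) (f : L2) : (inner ℂ f (μ • f)).re = μ.re * ‖f‖ ^ 2 := by
  have h1 : (inner ℂ f f).re = ‖f‖ ^ 2 := inner_self_eq_norm_sq (𝕜 := ℂ) f
  have h2 : (inner ℂ f f).im = 0 := inner_self_im (𝕜 := ℂ) f
  rw [inner_smul_right, Complex.mul_re, h1, h2, mul_zero, sub_zero]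

/-- `d/dx + μ` is invertible on `L²(ℝ)` for `Re μ ≠ 0`. -/
theorem exists_inverse_deriv_add (μ : ℂ) (hμ : μ.re ≠ 0) :
    ∃ S : L2 →L[ℂ] L2, ∀ f, IsWeakDeriv univ (S f) (f - μ • S f) := by
  have : CompleteSpace weakDerivGraph := isClosed_weakDerivGraph.completeSpace_coe
  let T : weakDerivGraph →L[ℂ] L2 :=
    (ContinuousLinearMap.snd ℂ L2 L2 + μ • ContinuousLinearMap.fst ℂ L2 L2).comp
      weakDerivGraph.subtypeL
  have hT : ∀ p, T p = p.1.2 + μ • p.1.1 := fun p => rfl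
  have hb1 : ∀ p : weakDerivGraph, ‖p.1.1‖ ≤ |μ.re|⁻¹ * ‖T p‖ := by
    intro p
    -- Since $d/dx$ is skew-symmetric, only $\mu$ contributes to the real part.
    have hre : (inner ℂ p.1.1 (T p)).re = μ.re * ‖p.1.1‖ ^ 2 := by
      have := IsWeakDeriv.re_inner_eq_zero p.2
      rw [hT, inner_add_right, Complex.add_re, this, zero_add, re_inner_smul_self]
    have h1 : |μ.re| * ‖p.1.1‖ ^ 2 ≤ ‖p.1.1‖ * ‖T p‖ := by
      rw [← abs_of_nonneg (sq_nonneg ‖p.1.1‖), ← abs_mul, ← hre]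
      exact (Complex.abs_re_le_norm _).trans (norm_inner_le_norm _ _)
    have hpos : 0 < |μ.re| := abs_pos.2 hμ
    rw [inv_mul_eq_div, le_div_iff₀ hpos]
    rcases (norm_nonneg p.1.1).eq_or_lt with h0 | h0
    · rw [← h0, zero_mul]; exact norm_nonneg _
    · nlinarith
  obtain ⟨S, hS⟩ := exists_rightInverse T (|μ.re|⁻¹ + (1 + ‖μ‖ * |μ.re|⁻¹)) (fun p => by
      have h2 : ‖p.1.2‖ ≤ (1 + ‖μ‖ * |μ.re|⁻¹) * ‖T p‖ := by
        have : p.1.2 = T p - μ • p.1.1 := by rw [hT]; abel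
        calc ‖p.1.2‖ ≤ ‖T p‖ + ‖μ • p.1.1‖ := by rw [this]; exact norm_sub_le _ _
          _ ≤ ‖T p‖ + ‖μ‖ * (|μ.re|⁻¹ * ‖T p‖) := by
            rw [norm_smul]; gcongr; exact hb1 p
          _ = _ := by ring
      have h3 : ‖p‖ = max ‖p.1.1‖ ‖p.1.2‖ := rfl
      have h4 : 0 ≤ (1 + ‖μ‖ * |μ.re|⁻¹) * ‖T p‖ := by positivity
      have h5 : 0 ≤ |μ.re|⁻¹ * ‖T p‖ := by positivity
      rw [h3, add_mul]
      exact max_le (by linarith [hb1 p]) (by linarith)) (fun h hh => by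
      -- Orthogonality to the images of test functions says $h'=\bar\mu h$ weakly. Skew-symmetry
      -- then gives $\Re\mu\,\|h\|^2=0$.
      have hw : IsWeakDeriv univ h (starRingEnd ℂ μ • h) := by
        intro φ hφ hc _
        have h1 : inner ℂ (testL2 (deriv φ) (hφ.continuous_deriv (by simp)) hc.deriv +
            μ • testL2 φ hφ.continuous hc) h = 0 := hh ⟨(_, _), isWeakDeriv_testL2 hφ hc⟩
        rw [inner_add_left, inner_smul_left] at h1
        rw [← inner_testL2 φ hφ.continuous hc, ← inner_testL2 (deriv φ)
          (hφ.continuous_deriv (by simp)) hc.deriv, inner_smul_right]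
        exact eq_neg_of_add_eq_zero_left h1
      have h0 := hw.re_inner_eq_zero
      rw [re_inner_smul_self, Complex.conj_re] at h0
      simpa [hμ] using h0)
  refine ⟨(ContinuousLinearMap.fst ℂ L2 L2).comp (weakDerivGraph.subtypeL.comp S), fun f => ?_⟩
  have h1 := hS f
  rw [hT] at h1
  have h2 : IsWeakDeriv univ (S f).1.1 (S f).1.2 := (S f).2
  rw [eq_sub_of_add_eq h1] at h2
  exact h2

theorem IsWeakDeriv.sub {Ω : Set ℝ} {f g f' g' : L2} (h : IsWeakDeriv Ω f g)
    (h' : IsWeakDeriv Ω f' g') : IsWeakDeriv Ω (f - f') (g - g') := by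
  simpa [sub_eq_add_neg] using h.add (h'.smul (-1))

/-- The free resolvent `-2 (d² + κ²)⁻¹`, together with its derivative. -/
theorem exists_freeResolvent (κ : ℂ) (hκ : κ.im ≠ 0) :
    ∃ R G : L2 →L[ℂ] L2, ∀ f, IsWeakDeriv univ (R f) (G f) ∧
      IsWeakDeriv univ (G f) (-(κ ^ 2) • R f - (2 : ℂ) • f) := by
  -- The factorization $d^2+\kappa^2=(d-i\kappa)(d+i\kappa)$ reduces the problem to two first-order
  -- inverses.
  obtain ⟨S, hS⟩ := exists_inverse_deriv_add (Complex.I * κ) (by simpa using hκ)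
  obtain ⟨S', hS'⟩ := exists_inverse_deriv_add (-(Complex.I * κ)) (by simpa using hκ)
  refine ⟨(-2 : ℂ) • S.comp S', (-2 : ℂ) • (S' - (Complex.I * κ) • S.comp S'), fun f => ?_⟩
  have h1 := hS (S' f)
  have h2 := hS' f
  refine ⟨h1.smul (-2), ?_⟩
  have h3 := (h2.sub (h1.smul (Complex.I * κ))).smul (-2)
  have hI : Complex.I * κ * (Complex.I * κ) = -κ ^ 2 := by
    linear_combination κ ^ 2 * Complex.I_mul_I
  have e : -(κ ^ 2) • ((-2 : ℂ) • S.comp S') f - (2 : ℂ) • f =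
      (-2 : ℂ) • (f - -(Complex.I * κ) • S' f -
        (Complex.I * κ) • (S' f - (Complex.I * κ) • S (S' f))) := by
    simp only [_root_.smul_apply, ContinuousLinearMap.comp_apply]
    simp only [smul_sub, smul_smul, neg_smul, hI]
    module
  rw [e]
  exact h3

/-! ### Decaying exponentials and square-integrable solutions on half-lines -/

/-- Cauchy-Schwarz. -/
theorem integral_norm_mul_le {μ : Measure ℝ} {f g : ℝ → ℂ} (hf : MemLp f 2 μ) (hg : MemLp g 2 μ) :
    ∫ x, ‖f x‖ * ‖g x‖ ∂μ ≤ (eLpNorm f 2 μ).toReal * (eLpNorm g 2 μ).toReal := by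
  have key : ∀ {f : ℝ → ℂ}, MemLp f 2 μ →
      (eLpNorm f 2 μ).toReal = (∫ x, ‖f x‖ ^ (2 : ℝ) ∂μ) ^ (1 / (2 : ℝ)) := by
    intro f hf
    rw [hf.eLpNorm_eq_integral_rpow_norm (by norm_num) (by norm_num), ENNReal.toReal_ofReal]
    · simp
    · positivity
  rw [key hf, key hg]
  exact integral_mul_norm_le_Lp_mul_Lq Real.HolderConjugate.two_two (by simpa using hf)
    (by simpa using hg)

theorem eLpNorm_restrict_le_norm (f : L2) (s : Set ℝ) :
    (eLpNorm f 2 (volume.restrict s)).toReal ≤ ‖f‖ := by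
  rw [Lp.norm_def]
  exact ENNReal.toReal_mono (Lp.eLpNorm_ne_top f) (eLpNorm_mono_measure _ Measure.restrict_le_self)

theorem integral_norm_Ioc_le (f : L2) {a b : ℝ} (hab : a ≤ b) :
    ∫ x in Ioc a b, ‖f x‖ ≤ √(b - a) * ‖f‖ := by
  have h1 : MemLp (fun _ : ℝ => (1 : ℂ)) 2 (volume.restrict (Ioc a b)) := memLp_const 1
  have h := integral_norm_mul_le h1 ((Lp.memLp f).restrict (Ioc a b))
  simp only [norm_one, one_mul] at h
  refine h.trans (mul_le_mul (le_of_eq ?_) (eLpNorm_restrict_le_norm f _)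
    ENNReal.toReal_nonneg (Real.sqrt_nonneg _))
  rw [eLpNorm_const' _ (by norm_num) (by norm_num)]
  simp [Real.sqrt_eq_rpow, ENNReal.toReal_ofReal, hab,
    ← ENNReal.toReal_rpow]

/-- `exp (i κ |x|)`. -/
noncomputable def expAbs (κ : ℂ) (x : ℝ) : ℂ := Complex.exp (Complex.I * κ * (|x| : ℝ))

/-- The derivative of `exp (i κ |x|)` away from the origin. -/
noncomputable def expAbsDeriv (κ : ℂ) (x : ℝ) : ℂ :=
  (Real.sign x : ℝ) * (Complex.I * κ * expAbs κ x)

theorem expAbs_neg (κ : ℂ) (x : ℝ) : expAbs κ (-x) = expAbs κ x := by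
  rw [expAbs, abs_neg, expAbs]

theorem continuous_expAbs (κ : ℂ) : Continuous (expAbs κ) := by
  unfold expAbs; fun_prop

theorem norm_expAbs (κ : ℂ) (x : ℝ) : ‖expAbs κ x‖ = Real.exp (-κ.im * |x|) := by
  rw [expAbs, Complex.norm_exp]
  simp

theorem expAbs_zero (κ : ℂ) : expAbs κ 0 = 1 := by simp [expAbs]

theorem memLp_expAbs {κ : ℂ} (hκ : 0 < κ.im) : MemLp (expAbs κ) 2 (volume : Measure ℝ) := by
  rw [memLp_two_iff_integrable_sq_norm (continuous_expAbs κ).aestronglyMeasurable]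
  have e : (fun x : ℝ => ‖expAbs κ x‖ ^ 2) = fun x => Real.exp (-(2 * κ.im) * |x|) := by
    ext x
    rw [norm_expAbs, ← Real.exp_nat_mul]
    congr 1
    push_cast
    ring
  rw [e, ← integrableOn_univ, ← Iic_union_Ioi (a := (0 : ℝ))]
  refine IntegrableOn.union ?_ ?_
  · refine (integrableOn_exp_mul_Iic (show (0 : ℝ) < 2 * κ.im by positivity) 0).congr_fun
      (fun x hx => ?_) measurableSet_Iic
    simp only [abs_of_nonpos (mem_Iic.1 hx)]
    ring_nf
  · refine (integrableOn_exp_mul_Ioi (show -(2 * κ.im) < (0 : ℝ) by linarith) 0).congr_fun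
      (fun x hx => ?_) measurableSet_Ioi
    simp only [abs_of_pos (mem_Ioi.1 hx)]

theorem measurable_sign : Measurable Real.sign := by
  unfold Real.sign
  exact Measurable.ite measurableSet_Iio measurable_const
    (Measurable.ite measurableSet_Ioi measurable_const measurable_const)

theorem abs_sign_le (x : ℝ) : |Real.sign x| ≤ 1 := by
  rcases Real.sign_apply_eq x with h | h | h <;> simp [h]

theorem memLp_expAbsDeriv {κ : ℂ} (hκ : 0 < κ.im) :
    MemLp (expAbsDeriv κ) 2 (volume : Measure ℝ) := by
  refine ((memLp_expAbs hκ).const_mul (Complex.I * κ)).mono ?_ (Eventually.of_forall fun x => ?_)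
  · exact ((Complex.measurable_ofReal.comp measurable_sign).mul
      ((continuous_expAbs κ).measurable.const_mul _)).aestronglyMeasurable
  · rw [expAbsDeriv, norm_mul, Complex.norm_real]
    exact mul_le_of_le_one_left (norm_nonneg _) (abs_sign_le x)

theorem hasDerivAt_exp_mul (c : ℂ) (x : ℝ) :
    HasDerivAt (fun x : ℝ => Complex.exp (c * x)) (c * Complex.exp (c * x)) x := by
  have := ((Complex.ofRealCLM.hasDerivAt (x := x)).const_mul c).cexp
  simpa [mul_comm] using this

theorem isPrimitive_exp_mul (c : ℂ) :
    IsPrimitive (fun x : ℝ => Complex.exp (c * x)) (fun x : ℝ => c * Complex.exp (c * x)) :=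
  IsPrimitive.of_hasDerivAt (hasDerivAt_exp_mul c) (by fun_prop)

theorem isPrimitive_expAbs {κ : ℂ} (hκ : 0 < κ.im) :
    IsPrimitive (expAbs κ) (expAbsDeriv κ) := by
  have hl : LocallyIntegrable (expAbsDeriv κ) :=
    (memLp_expAbsDeriv hκ).locallyIntegrable (by norm_num)
  refine ⟨hl, fun a b => (integral_eq_of_hasDerivAt_off_countable _ _ (countable_singleton 0)
    (continuous_expAbs κ).continuousOn (fun x hx => ?_)
    (intervalIntegrable_of_locallyIntegrable hl a b)).symm⟩
  rcases lt_or_gt_of_ne (show x ≠ 0 from hx.2) with h | h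
  · have := hasDerivAt_exp_mul (-(Complex.I * κ)) x
    refine (this.congr_of_eventuallyEq ?_).congr_deriv ?_
    · filter_upwards [Iio_mem_nhds h] with y hy
      simp [expAbs, abs_of_neg (mem_Iio.1 hy)]
    · simp [expAbsDeriv, expAbs, Real.sign_of_neg h, abs_of_neg h]
  · have := hasDerivAt_exp_mul (Complex.I * κ) x
    refine (this.congr_of_eventuallyEq ?_).congr_deriv ?_
    · filter_upwards [Ioi_mem_nhds h] with y hy
      simp [expAbs, abs_of_pos (mem_Ioi.1 hy)]
    · simp [expAbsDeriv, expAbs, Real.sign_of_pos h, abs_of_pos h]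

/-- `F` is an `H²` solution of `F'' + κ² F = -2 f` on the half-line `(c, ∞)` with derivative
`F'`. -/
def IsHalfLineSol (κ : ℂ) (f F F' : ℝ → ℂ) (c : ℝ) : Prop :=
  ∃ g h : ℝ → ℂ, IsPrimitive F g ∧ IsPrimitive F' h ∧ (∀ᵐ x, c < x → g x = F' x) ∧
    (∀ᵐ x, c < x → h x = -κ ^ 2 * F x - 2 * f x) ∧ MemLp F 2 (volume.restrict (Ioi c)) ∧
    MemLp F' 2 (volume.restrict (Ioi c))

namespace IsHalfLineSol

variable {κ : ℂ} {f F F' f₁ F₁ F₁' : ℝ → ℂ} {c d : ℝ}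

theorem mono (h : IsHalfLineSol κ f F F' c) (hcd : c ≤ d) : IsHalfLineSol κ f F F' d := by
  obtain ⟨g, k, h1, h2, h3, h4, h5, h6⟩ := h
  have hr : (volume : Measure ℝ).restrict (Ioi d) ≤ volume.restrict (Ioi c) :=
    Measure.restrict_mono (Ioi_subset_Ioi hcd) le_rfl
  refine ⟨g, k, h1, h2, ?_, ?_, h5.mono_measure hr, h6.mono_measure hr⟩
  · filter_upwards [h3] with x hx hdx using hx (hcd.trans_lt hdx)
  · filter_upwards [h4] with x hx hdx using hx (hcd.trans_lt hdx)

theorem sub_const_mul (h : IsHalfLineSol κ f F F' c) (h' : IsHalfLineSol κ f₁ F₁ F₁' c) (a : ℂ) :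
    IsHalfLineSol κ (fun x => f x - a * f₁ x) (fun x => F x - a * F₁ x)
      (fun x => F' x - a * F₁' x) c := by
  obtain ⟨g, k, h1, h2, h3, h4, h5, h6⟩ := h
  obtain ⟨g', k', h1', h2', h3', h4', h5', h6'⟩ := h'
  refine ⟨_, _, h1.sub (h1'.const_mul a), h2.sub (h2'.const_mul a), ?_, ?_,
    h5.sub (h5'.const_mul a), h6.sub (h6'.const_mul a)⟩
  · filter_upwards [h3, h3'] with x hx hx' hc
    rw [hx hc, hx' hc]
  · filter_upwards [h4, h4'] with x hx hx' hc
    rw [hx hc, hx' hc]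
    ring

theorem congr_rhs (h : IsHalfLineSol κ f F F' c) (hf : ∀ᵐ x, c < x → f x = f₁ x) :
    IsHalfLineSol κ f₁ F F' c := by
  obtain ⟨g, k, h1, h2, h3, h4, h5, h6⟩ := h
  refine ⟨g, k, h1, h2, h3, ?_, h5, h6⟩
  filter_upwards [h4, hf] with x hx hfx hc
  rw [hx hc, hfx hc]

/-- The derivative of $e^{i\kappa x}(F'-i\kappa F)$ is $e^{i\kappa x}(F''+\kappa^2F)=-2e^{i\kappa
x}f$. Integrate over $(c,\infty)$, where there is no contribution at infinity, and apply
Cauchy–Schwarz. Dividing by $|e^{i\kappa c}|$ produces the factor $e^{c\,\Im\kappa}$. -/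
theorem norm_deriv_sub_le (h : IsHalfLineSol κ f F F' c) (hκ : 0 < κ.im) (hc : 0 ≤ c)
    (hf : MemLp f 2 (volume : Measure ℝ)) :
    ‖F' c - Complex.I * κ * F c‖ ≤
      2 * Real.exp (κ.im * c) * (eLpNorm (expAbs κ) 2 volume).toReal *
        (eLpNorm f 2 volume).toReal := by
  obtain ⟨g, k, h1, h2, h3, h4, h5, h6⟩ := h
  have hE : ∀ x, c < x → Complex.exp (Complex.I * κ * x) = expAbs κ x := fun x hx => by
    rw [expAbs, abs_of_pos (hc.trans_lt hx)]
  have hm := (isPrimitive_exp_mul (Complex.I * κ)).mul (h2.sub (h1.const_mul (Complex.I * κ)))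
  have hEr : MemLp (expAbs κ) 2 (volume.restrict (Ioi c)) := (memLp_expAbs hκ).restrict _
  have hi : IntegrableOn (fun x : ℝ => Complex.exp (Complex.I * κ * x) *
      (F' x - Complex.I * κ * F x)) (Ioi c) :=
    (hEr.integrable_mul (h6.sub (h5.const_mul (Complex.I * κ)))).congr
      ((ae_restrict_iff' measurableSet_Ioi).2 (Eventually.of_forall fun x hx => by
        beta_reduce
        rw [hE x hx]; rfl))
  have hEf : Integrable (fun x => expAbs κ x * f x) := (memLp_expAbs hκ).integrable_mul hf
  have e : (fun x : ℝ => Complex.I * κ * Complex.exp (Complex.I * κ * x) *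
      (F' x - Complex.I * κ * F x) + Complex.exp (Complex.I * κ * x) *
      (k x - Complex.I * κ * g x)) =ᵐ[volume.restrict (Ioi c)]
      fun x => -2 * (expAbs κ x * f x) := by
    rw [EventuallyEq, ae_restrict_iff' measurableSet_Ioi]
    filter_upwards [h3, h4] with x hx3 hx4 hx
    rw [hx3 hx, hx4 hx, hE x hx]
    linear_combination -(κ ^ 2 * F x * expAbs κ x) * Complex.I_mul_I
  have key := hm.integral_Ioi hi ((hEf.integrableOn.const_mul (-2)).congr e.symm)
  rw [integral_congr_ae e, integral_const_mul] at key
  have hn : Real.exp (-(κ.im * c)) * ‖F' c - Complex.I * κ * F c‖ ≤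
      2 * ((eLpNorm (expAbs κ) 2 volume).toReal * (eLpNorm f 2 volume).toReal) := by
    have e1 : ‖Complex.exp (Complex.I * κ * c)‖ = Real.exp (-(κ.im * c)) := by
      rw [Complex.norm_exp]; simp
    calc _ = ‖-2 * ∫ x in Ioi c, expAbs κ x * f x‖ := by rw [key, norm_neg, norm_mul, e1]
      _ = 2 * ‖∫ x in Ioi c, expAbs κ x * f x‖ := by rw [norm_mul]; simp
      _ ≤ 2 * ∫ x, ‖expAbs κ x * f x‖ := by
        gcongr
        exact (norm_integral_le_integral_norm _).trans
          (setIntegral_le_integral hEf.norm (Eventually.of_forall fun x => norm_nonneg _))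
      _ ≤ _ := by
        simp only [norm_mul]
        gcongr
        exact integral_norm_mul_le (memLp_expAbs hκ) hf
  calc _ = Real.exp (κ.im * c) * (Real.exp (-(κ.im * c)) * ‖F' c - Complex.I * κ * F c‖) := by
        rw [← mul_assoc, ← Real.exp_add]; simp
    _ ≤ Real.exp (κ.im * c) * (2 * ((eLpNorm (expAbs κ) 2 volume).toReal *
        (eLpNorm f 2 volume).toReal)) := mul_le_mul_of_nonneg_left hn (Real.exp_pos _).le
    _ = _ := by ring

/-- For a zero right-hand side the preceding estimate, applied from every $y\ge c$, forces
$F'=i\kappa F$; hence $e^{-i\kappa x}F$ is constant. -/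
theorem eq_mul_exp (h : IsHalfLineSol κ (fun _ => 0) F F' c) (hκ : 0 < κ.im) (hc : 0 ≤ c)
    {x : ℝ} (hx : c ≤ x) : F x = F c * Complex.exp (Complex.I * κ * (x - c : ℝ)) := by
  have h0 : ∀ y, c ≤ y → F' y = Complex.I * κ * F y := by
    intro y hy
    have := (h.mono hy).norm_deriv_sub_le hκ (hc.trans hy) MemLp.zero'
    have hz : eLpNorm (fun _ : ℝ => (0 : ℂ)) 2 volume = 0 := eLpNorm_zero'
    rw [hz, ENNReal.toReal_zero, mul_zero, norm_le_zero_iff, sub_eq_zero] at this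
    exact this
  obtain ⟨g, k, h1, -, h3, -, -, -⟩ := h
  have hm := (isPrimitive_exp_mul (-(Complex.I * κ))).mul h1
  have key := hm.sub_eq c x
  rw [intervalIntegral.integral_congr_ae (g := fun _ => 0), intervalIntegral.integral_zero,
    sub_eq_zero] at key
  · have e : Complex.exp (Complex.I * κ * (x - c : ℝ)) =
        Complex.exp (-(Complex.I * κ) * c) * Complex.exp (Complex.I * κ * x) := by
      rw [← Complex.exp_add]; congr 1; push_cast; ring
    rw [e, ← mul_assoc, mul_comm (F c), ← key, mul_right_comm, ← Complex.exp_add]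
    simp
  · filter_upwards [h3] with y hy hyx
    rw [uIoc_of_le hx] at hyx
    rw [hy hyx.1, h0 y hyx.1.le]
    ring

end IsHalfLineSol

/-- The derivative slot holds $i\kappa e^{i\kappa x}$ and not `expAbsDeriv`, which jumps at the
origin and so is not a primitive. The two agree on the half-line, which is all that is required. -/
theorem isHalfLineSol_expAbs {κ : ℂ} (hκ : 0 < κ.im) :
    IsHalfLineSol κ (fun _ => 0) (expAbs κ)
      (fun x => Complex.I * κ * Complex.exp (Complex.I * κ * x)) 0 := by
  refine ⟨_, _, isPrimitive_expAbs hκ, (isPrimitive_exp_mul (Complex.I * κ)).const_mul _, ?_, ?_,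
    (memLp_expAbs hκ).restrict _, ?_⟩
  · refine Eventually.of_forall fun x hx => ?_
    rw [expAbsDeriv, Real.sign_of_pos hx, expAbs, abs_of_pos hx, Complex.ofReal_one, one_mul]
  · refine Eventually.of_forall fun x hx => ?_
    rw [expAbs, abs_of_pos hx]
    linear_combination (κ ^ 2 * Complex.exp (Complex.I * κ * x)) * Complex.I_mul_I
  · refine (((memLp_expAbs hκ).restrict (Ioi 0)).const_mul (Complex.I * κ)).ae_eq ?_
    rw [EventuallyEq, ae_restrict_iff' measurableSet_Ioi]
    refine Eventually.of_forall fun x hx => ?_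
    rw [expAbs, abs_of_pos hx]

/-! ### The Dirichlet operator and its resolvent -/

theorem secondDeriv_eq {Ω : Set ℝ} (hΩ : IsOpen Ω) (h0 : volume Ωᶜ = 0) (u : sobolevH2 Ω)
    {g h : L2} (hg : IsWeakDeriv Ω u g) (hh : IsWeakDeriv Ω g h) :
    secondDeriv Ω hΩ h0 u = h :=
  second_unique hΩ h0 (exists_second Ω u).choose_spec ⟨g, hg, hh⟩

theorem schrodinger_apply (V : ℝ → ℝ) (hV : MemLp V ∞ (volume : Measure ℝ))
    (u : (schrodinger V hV).domain) {g h : L2} (hg : IsWeakDeriv univ u g)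
    (hh : IsWeakDeriv univ g h) :
    schrodinger V hV u = (-(1 / 2) : ℂ) • h + mulL2 V hV u := by
  rw [← secondDeriv_eq isOpen_univ (by simp) u hg hh]
  rfl

theorem dirichletOp_apply (u : dirichletOp.domain) {g h : L2} (hg : IsWeakDeriv {0}ᶜ u g)
    (hh : IsWeakDeriv {0}ᶜ g h) : dirichletOp u = (-(1 / 2) : ℂ) • h := by
  rw [← secondDeriv_eq isOpen_compl_singleton (by simp)
    (Submodule.inclusion dirichletDomain_le u) hg hh]
  rfl

/-- Multiplying a test function supported away from the origin by the sign function. -/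
theorem sign_mul_test {φ : ℝ → ℝ} (hφ : ContDiff ℝ ∞ φ) (hs : tsupport φ ⊆ {0}ᶜ) :
    ContDiff ℝ ∞ (fun x => Real.sign x * φ x) ∧
      deriv (fun x => Real.sign x * φ x) = fun x => Real.sign x * deriv φ x := by
  have key : ∀ x, ∃ c : ℝ, (fun x => Real.sign x * φ x) =ᶠ[𝓝 x] (fun x => c * φ x) ∧
      Real.sign x * deriv φ x = c * deriv φ x := by
    intro x
    rcases lt_trichotomy x 0 with h | rfl | h
    · refine ⟨-1, ?_, by rw [Real.sign_of_neg h]⟩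
      filter_upwards [Iio_mem_nhds h] with y hy
      rw [Real.sign_of_neg hy]
    · have h0 : (0 : ℝ) ∉ tsupport φ := fun h => hs h rfl
      refine ⟨0, ?_, by simp⟩
      filter_upwards [notMem_tsupport_iff_eventuallyEq.1 h0] with y hy
      simp [hy]
    · refine ⟨1, ?_, by rw [Real.sign_of_pos h]⟩
      filter_upwards [Ioi_mem_nhds h] with y hy
      rw [Real.sign_of_pos hy]
  constructor
  · rw [contDiff_iff_contDiffAt]
    intro x
    obtain ⟨c, hc, -⟩ := key x
    exact (contDiff_const.mul hφ).contDiffAt.congr_of_eventuallyEq hc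
  · ext x
    obtain ⟨c, hc, h'⟩ := key x
    rw [hc.deriv_eq, h', deriv_const_mul _ (hφ.differentiable (by simp) x)]

section Dirichlet

variable {κ : ℂ}

/-- `exp (i κ |x|)` as an element of `L²(ℝ)`. -/
noncomputable def expAbsL2 (hκ : 0 < κ.im) : L2 := (memLp_expAbs hκ).toLp

/-- The derivative of `exp (i κ |x|)` as an element of `L²(ℝ)`. -/
noncomputable def expAbsDerivL2 (hκ : 0 < κ.im) : L2 := (memLp_expAbsDeriv hκ).toLp

theorem coe_expAbsL2 (hκ : 0 < κ.im) : (expAbsL2 hκ : ℝ → ℂ) =ᵐ[volume] expAbs κ :=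
  MemLp.coeFn_toLp _

theorem coe_expAbsDerivL2 (hκ : 0 < κ.im) :
    (expAbsDerivL2 hκ : ℝ → ℂ) =ᵐ[volume] expAbsDeriv κ := MemLp.coeFn_toLp _

theorem isWeakDeriv_expAbs (hκ : 0 < κ.im) (Ω : Set ℝ) :
    IsWeakDeriv Ω (expAbsL2 hκ) (expAbsDerivL2 hκ) :=
  ((isPrimitive_expAbs hκ).congr_ae (coe_expAbsDerivL2 hκ).symm).isWeakDeriv (coe_expAbsL2 hκ) Ω

/-- The sign factor can be moved onto the test function, which stays smooth because its support
avoids the origin. What remains is the weak derivative of $e^{i\kappa|x|}$ itself. -/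
theorem isWeakDeriv_expAbsDeriv (hκ : 0 < κ.im) :
    IsWeakDeriv {0}ᶜ (expAbsDerivL2 hκ) (-(κ ^ 2) • expAbsL2 hκ) := by
  intro φ hφ hc hs
  obtain ⟨h1, h2⟩ := sign_mul_test hφ hs
  have h := (isPrimitive_expAbs hκ).integral_deriv_smul (h1.of_le (by simp))
    (hc.mul_left (f := Real.sign))
  rw [h2] at h
  have e1 : ∫ x, deriv φ x • expAbsDerivL2 hκ x =
      ∫ x, (Complex.I * κ) * ((Real.sign x * deriv φ x) • expAbs κ x) := by
    apply integral_congr_ae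
    filter_upwards [coe_expAbsDerivL2 hκ] with x hx
    rw [hx, expAbsDeriv, Complex.real_smul, Complex.real_smul]
    push_cast
    ring
  have e2 : ∫ x, φ x • (-(κ ^ 2) • expAbsL2 hκ : L2) x =
      ∫ x, (Complex.I * κ) * ((Real.sign x * φ x) • expAbsDeriv κ x) := by
    apply integral_congr_ae
    filter_upwards [coe_expAbsL2 hκ, Lp.coeFn_smul (-(κ ^ 2)) (expAbsL2 hκ),
      compl_mem_ae_iff.2 (measure_singleton (0 : ℝ))] with x hx hx' hx0
    have hs2 : ((Real.sign x : ℝ) : ℂ) * (Real.sign x : ℝ) = 1 := by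
      rcases lt_or_gt_of_ne (show x ≠ 0 from hx0) with h | h
      · simp [Real.sign_of_neg h]
      · simp [Real.sign_of_pos h]
    rw [hx', Pi.smul_apply, hx, expAbsDeriv, Complex.real_smul, Complex.real_smul, smul_eq_mul]
    push_cast
    linear_combination (-(κ ^ 2 * φ x * expAbs κ x)) * Complex.I_mul_I -
      (κ ^ 2 * φ x * expAbs κ x * Complex.I * Complex.I) * hs2
  rw [e1, e2, integral_const_mul, integral_const_mul, h, mul_neg]

theorem toReal_eLpNorm_comp_neg (f : L2) :
    (eLpNorm (fun x => f (-x)) 2 volume).toReal = ‖f‖ := by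
  rw [Lp.norm_def, ← eLpNorm_comp_measurePreserving (Lp.aestronglyMeasurable f)
    (Measure.measurePreserving_neg (volume : Measure ℝ))]
  rfl

theorem memLp_comp_neg (f : L2) : MemLp (fun x => f (-x)) 2 (volume : Measure ℝ) :=
  (Lp.memLp f).comp_measurePreserving (Measure.measurePreserving_neg _)

/-- Reversal of an almost everywhere statement. -/
theorem ae_neg {p : ℝ → Prop} (h : ∀ᵐ x, p x) : ∀ᵐ x : ℝ, p (-x) :=
  (Measure.measurePreserving_neg (volume : Measure ℝ)).quasiMeasurePreserving.ae h

/-- The restriction to `(c, ∞)` of a solution in `L²`. -/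
theorem isHalfLineSol_of_isPrimitive {u g h f : L2} {F F' : ℝ → ℂ} {c : ℝ} (hF : IsPrimitive F g)
    (hF' : IsPrimitive F' h) (hu : ∀ᵐ x, c < x → u x = F x) (hg : ∀ᵐ x, c < x → g x = F' x)
    (hh : ∀ᵐ x, c < x → h x = -κ ^ 2 * F x - 2 * f x) : IsHalfLineSol κ f F F' c := by
  refine ⟨g, h, hF, hF', hg, hh, ((Lp.memLp u).restrict _).ae_eq ?_,
    ((Lp.memLp g).restrict _).ae_eq ?_⟩ <;>
  rwa [EventuallyEq, ae_restrict_iff' measurableSet_Ioi]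

/-- The reflection of a solution in `L²` on `(-∞, -c)`. -/
theorem isHalfLineSol_comp_neg {u g h f : L2} {F F' : ℝ → ℂ} {c : ℝ} (hF : IsPrimitive F g)
    (hF' : IsPrimitive F' h) (hu : ∀ᵐ x, x < -c → u x = F x) (hg : ∀ᵐ x, x < -c → g x = F' x)
    (hh : ∀ᵐ x, x < -c → h x = -κ ^ 2 * F x - 2 * f x) :
    IsHalfLineSol κ (fun x => f (-x)) (fun x => F (-x)) (fun x => -F' (-x)) c := by
  refine ⟨_, _, hF.comp_neg, hF'.comp_neg.neg, ?_, ?_, ((memLp_comp_neg u).restrict _).ae_eq ?_,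
    ((memLp_comp_neg g).neg.restrict _).ae_eq ?_⟩
  · filter_upwards [ae_neg hg] with x hx hc
    rw [hx (by linarith)]
  · filter_upwards [ae_neg hh] with x hx hc
    rw [neg_neg, hx (by linarith)]
  · rw [EventuallyEq, ae_restrict_iff' measurableSet_Ioi]
    filter_upwards [ae_neg hu] with x hx hc
    exact hx (neg_lt_neg hc)
  · rw [EventuallyEq, ae_restrict_iff' measurableSet_Ioi]
    filter_upwards [ae_neg hg] with x hx hc
    rw [Pi.neg_apply, hx (neg_lt_neg hc)]

/-- Evaluation at `0` of the continuous representative, as a bounded functional. -/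
theorem exists_evalCLM (R : L2 →L[ℂ] L2) (C : ℝ)
    (h : ∀ f, ∃ F : ℝ → ℂ, Continuous F ∧ (R f : ℝ → ℂ) =ᵐ[volume] F ∧ ‖F 0‖ ≤ C * ‖f‖) :
    ∃ l : L2 →L[ℂ] ℂ, ∀ f (F : ℝ → ℂ), Continuous F → (R f : ℝ → ℂ) =ᵐ[volume] F → F 0 = l f := by
  choose F hF hR hb using h
  have hu : ∀ f (G : ℝ → ℂ), Continuous G → (R f : ℝ → ℂ) =ᵐ[volume] G → G 0 = F f 0 :=
    fun f G hG hRG => congrFun (((hG.ae_eq_iff_eq volume (hF f)).1 (hRG.symm.trans (hR f)))) 0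
  let l : L2 →ₗ[ℂ] ℂ :=
    { toFun := fun f => F f 0
      map_add' := fun f f' => by
        refine (hu (f + f') (F f + F f') ((hF f).add (hF f')) ?_).symm
        rw [map_add]
        exact (Lp.coeFn_add _ _).trans ((hR f).add (hR f'))
      map_smul' := fun c f => by
        refine (hu (c • f) (c • F f) ((hF f).const_smul c) ?_).symm
        rw [map_smul]
        exact (Lp.coeFn_smul _ _).trans ((hR f).const_smul c) }
  exact ⟨l.mkContinuous C hb, hu⟩

/-- Hölder-1/2 continuity from Cauchy–Schwarz; this is the source of the rate $\sqrt\delta$. -/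
theorem norm_sub_le_of_isPrimitive {F : ℝ → ℂ} {g : L2} (hF : IsPrimitive F g) (x : ℝ) :
    ‖F x - F 0‖ ≤ √|x| * ‖g‖ := by
  rw [hF.sub_eq]
  refine (intervalIntegral.norm_integral_le_integral_norm_uIoc).trans ?_
  refine (integral_norm_Ioc_le g inf_le_sup).trans (le_of_eq ?_)
  congr 2
  exact (max_sub_min_eq_abs' 0 x).trans (by rw [zero_sub, abs_neg])

/-- A solution of the homogeneous equation on a half-line that vanishes at the end point. -/
theorem ae_eq_zero_of_dirichlet (hκ : 0 < κ.im) {f F F' : ℝ → ℂ}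
    (h : IsHalfLineSol κ f F F' 0) (hf : ∀ᵐ x, (0 : ℝ) < x → f x = 0) (h0 : F 0 = 0) {x : ℝ}
    (hx : 0 < x) : F x = 0 := by
  rw [(h.congr_rhs (f₁ := fun _ => 0) hf).eq_mul_exp hκ le_rfl hx.le, h0, zero_mul]

theorem eq_of_ae_eq_Ioi {F G : ℝ → ℂ} (hF : Continuous F) (hG : Continuous G)
    (h : ∀ᵐ x, (0 : ℝ) < x → F x = G x) : F 0 = G 0 := by
  have : EqOn F G (Ici 0) := by
    refine Measure.eqOn_of_ae_eq (μ := volume) ?_ hF.continuousOn hG.continuousOn (by simp)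
    rw [← restrict_Ioi_eq_restrict_Ici]
    exact (ae_restrict_iff' measurableSet_Ioi).2 h
  exact this self_mem_Ici

/-- On each half-line an $L^2$ solution of the homogeneous equation is its value at the origin times
a decaying exponential, and the Dirichlet condition makes that value zero. -/
theorem dirichlet_injective (hκ : 0 < κ.im) {z : ℂ} (hz : κ ^ 2 = 2 * z ^ 2)
    (u : dirichletOp.domain) (hu : dirichletOp u = z ^ 2 • (u : L2)) : (u : L2) = 0 := by
  obtain ⟨⟨g, h, hg, hh⟩, U, hU, hU0, huU⟩ := u.2
  rw [dirichletOp_apply u hg hh] at hu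
  have hh' : h = -(κ ^ 2) • (u : L2) := by
    have : h = (-2 : ℂ) • ((-(1 / 2) : ℂ) • h) := by rw [smul_smul]; norm_num
    rw [this, hu, smul_smul, hz]; congr 1; ring
  have hha : ∀ᵐ x, h x = -κ ^ 2 * u.1 x - 2 * (0 : L2) x := by
    filter_upwards [Lp.coeFn_smul (-(κ ^ 2)) (u : L2), Lp.coeFn_zero ℂ 2 (volume : Measure ℝ)]
      with x hx hx'
    rw [hh', hx, hx', Pi.smul_apply, smul_eq_mul, Pi.zero_apply, mul_zero, sub_zero]
  have hz0 : ∀ᵐ x, (0 : L2) x = 0 := Lp.coeFn_zero ℂ 2 (volume : Measure ℝ)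
  have hpos : ∀ᵐ x, (0 : ℝ) < x → u.1 x = 0 := by
    obtain ⟨F, hF, huF⟩ := hg.exists_isPrimitive isOpen_Ioi ordConnected_Ioi (nonempty_Ioi (a := (0 : ℝ)))
      (fun x hx => (ne_of_gt hx : x ≠ 0))
    obtain ⟨F', hF', hgF⟩ := hh.exists_isPrimitive isOpen_Ioi ordConnected_Ioi (nonempty_Ioi (a := (0 : ℝ)))
      (fun x hx => (ne_of_gt hx : x ≠ 0))
    have hs : IsHalfLineSol κ (0 : L2) F F' 0 := by
      refine isHalfLineSol_of_isPrimitive (u := u) hF hF' huF hgF ?_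
      filter_upwards [hha, huF] with x hx hx' h0
      rw [hx, hx' h0]
    have h0 : F 0 = 0 := by
      rw [← hU0]
      refine eq_of_ae_eq_Ioi hF.continuous hU ?_
      filter_upwards [huU, huF] with x hx hx' h0
      rw [← hx' h0, hx]
    filter_upwards [huF] with x hx hx0
    rw [hx hx0, ae_eq_zero_of_dirichlet hκ hs (by filter_upwards [hz0] with x hx _ using hx) h0 hx0]
  have hneg : ∀ᵐ x, x < (0 : ℝ) → u.1 x = 0 := by
    obtain ⟨F, hF, huF⟩ := hg.exists_isPrimitive isOpen_Iio ordConnected_Iio (nonempty_Iio (a := (0 : ℝ)))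
      (fun x hx => (ne_of_lt hx : x ≠ 0))
    obtain ⟨F', hF', hgF⟩ := hh.exists_isPrimitive isOpen_Iio ordConnected_Iio (nonempty_Iio (a := (0 : ℝ)))
      (fun x hx => (ne_of_lt hx : x ≠ 0))
    have hs : IsHalfLineSol κ (fun x => (0 : L2) (-x)) (fun x => F (-x)) (fun x => -F' (-x)) 0 := by
      refine isHalfLineSol_comp_neg (u := u) hF hF' (by simpa using huF) (by simpa using hgF) ?_
      filter_upwards [hha, huF] with x hx hx' h0
      rw [hx, hx' (by simpa using h0)]
    have h0 : F (-0) = 0 := by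
      rw [← hU0]
      refine (eq_of_ae_eq_Ioi (F := fun x => F (-x)) (G := fun x => U (-x))
        (hF.continuous.comp continuous_neg) (hU.comp continuous_neg) ?_).trans (by rw [neg_zero])
      filter_upwards [ae_neg huU, ae_neg huF] with x hx hx' h0
      rw [← hx' (by simpa using h0), hx]
    filter_upwards [huF] with x hx hx0
    have := ae_eq_zero_of_dirichlet hκ hs (by filter_upwards [ae_neg hz0] with x hx _ using hx) h0
      (neg_pos.2 hx0)
    rw [hx hx0, ← this, neg_neg]
  apply Lp.ext
  filter_upwards [hpos, hneg, compl_mem_ae_iff.2 (measure_singleton (0 : ℝ)),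
    Lp.coeFn_zero ℂ 2 (volume : Measure ℝ)] with x h1 h2 h3 h4
  rw [h4, Pi.zero_apply]
  rcases lt_or_gt_of_ne (show x ≠ 0 from h3) with h | h
  · exact h2 h
  · exact h1 h

end Dirichlet

/-- The resolvent of the Dirichlet operator, with its continuous representatives. -/
theorem exists_dirichletResolvent {κ z : ℂ} (hκ : 0 < κ.im) (hz : κ ^ 2 = 2 * z ^ 2) :
    ∃ (R : L2 →L[ℂ] L2) (C : ℝ), 0 ≤ C ∧ IsResolventAt dirichletOp (z ^ 2) R ∧
      ∀ f : L2, ∃ F : ℝ → ℂ, Continuous F ∧ (R f : ℝ → ℂ) =ᵐ[volume] F ∧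
        (∀ x, ‖F x‖ ≤ C * √|x| * ‖f‖) ∧ (∃ F', IsHalfLineSol κ f F F' 0) ∧
        ∃ F', IsHalfLineSol κ (fun x => f (-x)) (fun x => F (-x)) F' 0 := by
  obtain ⟨R, G, hRG⟩ := exists_freeResolvent κ hκ.ne'
  have hrep : ∀ f, ∃ F F' : ℝ → ℂ, IsPrimitive F (G f) ∧ (R f : ℝ → ℂ) =ᵐ[volume] F ∧
      IsHalfLineSol κ f F F' 0 ∧
      IsHalfLineSol κ (fun x => f (-x)) (fun x => F (-x)) (fun x => -F' (-x)) 0 := by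
    intro f
    obtain ⟨F, hF, hu⟩ := (hRG f).1.exists_isPrimitive_univ
    obtain ⟨F', hF', hg⟩ := (hRG f).2.exists_isPrimitive_univ
    have hh : ∀ᵐ x, (-(κ ^ 2) • R f - (2 : ℂ) • f : L2) x = -κ ^ 2 * F x - 2 * f x := by
      filter_upwards [Lp.coeFn_sub (-(κ ^ 2) • R f) ((2 : ℂ) • f), Lp.coeFn_smul (-(κ ^ 2)) (R f),
        Lp.coeFn_smul (2 : ℂ) f, hu] with x h1 h2 h3 h4
      rw [h1, Pi.sub_apply, h2, h3, Pi.smul_apply, Pi.smul_apply, h4, smul_eq_mul, smul_eq_mul]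
    refine ⟨F, F', hF, hu, ?_, ?_⟩
    · apply isHalfLineSol_of_isPrimitive (u := R f) hF hF'
      · filter_upwards [hu] with x hx _ using hx
      · filter_upwards [hg] with x hx _ using hx
      · filter_upwards [hh] with x hx _ using hx
    · apply isHalfLineSol_comp_neg (u := R f) hF hF'
      · filter_upwards [hu] with x hx _ using hx
      · filter_upwards [hg] with x hx _ using hx
      · filter_upwards [hh] with x hx _ using hx
  have hκ0 : κ ≠ 0 := fun h => by simp [h] at hκ
  obtain ⟨l, hl⟩ := exists_evalCLM R (2 * (eLpNorm (expAbs κ) 2 volume).toReal / ‖κ‖) (by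
    intro f
    obtain ⟨F, F', hF, hu, h1, h2⟩ := hrep f
    refine ⟨F, hF.continuous, hu, ?_⟩
    have b1 := h1.norm_deriv_sub_le hκ le_rfl (Lp.memLp f)
    have b2 := h2.norm_deriv_sub_le hκ le_rfl (memLp_comp_neg f)
    rw [toReal_eLpNorm_comp_neg] at b2
    rw [← Lp.norm_def] at b1
    simp only [neg_zero, mul_zero, Real.exp_zero, mul_one] at b1 b2
    -- Adding the bounds from the two half-lines cancels the unknown derivative at the origin and
    -- leaves a multiple of $F(0)$.
    have e : 2 * ‖κ‖ * ‖F 0‖ = ‖(F' 0 - Complex.I * κ * F 0) + (-F' 0 - Complex.I * κ * F 0)‖ := by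
      rw [show (F' 0 - Complex.I * κ * F 0) + (-F' 0 - Complex.I * κ * F 0) =
        -(2 * Complex.I) * κ * F 0 by ring, norm_mul, norm_mul]
      simp
    rw [div_mul_eq_mul_div, le_div_iff₀ (norm_pos_iff.2 hκ0)]
    linarith [norm_add_le (F' 0 - Complex.I * κ * F 0) (-F' 0 - Complex.I * κ * F 0)])
  -- Krein's formula: the Dirichlet resolvent is the free one minus the rank-one term
  -- $(Rf)(0)\,e^{i\kappa|x|}$, which removes the value at the origin.
  have hRD : ∀ f, (R - l.smulRight (expAbsL2 hκ)) f = R f - l f • expAbsL2 hκ := fun f => rfl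
  have hres : ∀ f, ∃ h : (R - l.smulRight (expAbsL2 hκ)) f ∈ dirichletOp.domain,
      dirichletOp ⟨_, h⟩ - z ^ 2 • (R - l.smulRight (expAbsL2 hκ)) f = f := by
    intro f
    obtain ⟨F, F', hF, hu, -, -⟩ := hrep f
    have d1 : IsWeakDeriv {0}ᶜ ((R - l.smulRight (expAbsL2 hκ)) f)
        (G f - l f • expAbsDerivL2 hκ) :=
      ((hRG f).1.mono (subset_univ _)).sub ((isWeakDeriv_expAbs hκ _).smul (l f))
    have d2 := ((hRG f).2.mono (subset_univ {0}ᶜ)).sub ((isWeakDeriv_expAbsDeriv hκ).smul (l f))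
    have hdom : (R - l.smulRight (expAbsL2 hκ)) f ∈ dirichletOp.domain := by
      refine ⟨⟨_, _, d1, d2⟩, fun x => F x - l f * expAbs κ x,
        hF.continuous.sub (continuous_const.mul (continuous_expAbs κ)), ?_, ?_⟩
      · beta_reduce
        rw [expAbs_zero, hl f F hF.continuous hu, mul_one, sub_self]
      · rw [hRD]
        filter_upwards [Lp.coeFn_sub (R f) (l f • expAbsL2 hκ), Lp.coeFn_smul (l f) (expAbsL2 hκ),
          hu, coe_expAbsL2 hκ] with x h1 h2 h3 h4
        rw [h1, Pi.sub_apply, h2, Pi.smul_apply, h3, h4, smul_eq_mul]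
    refine ⟨hdom, ?_⟩
    rw [dirichletOp_apply ⟨_, hdom⟩ d1 d2, hRD, hz]
    module
  -- The constant bounds the $L^2$ norm of the derivative of the Dirichlet solution in terms of
  -- $\|f\|$.
  refine ⟨R - l.smulRight (expAbsL2 hκ), ‖G‖ + ‖l‖ * ‖expAbsDerivL2 hκ‖, by positivity,
    ⟨hres, fun u => ?_⟩, fun f => ?_⟩
  · obtain ⟨hd, he⟩ := hres (dirichletOp u - z ^ 2 • (u : L2))
    set v : dirichletOp.domain := ⟨_, hd⟩ with hv
    have h0 : dirichletOp (v - u) = z ^ 2 • ((v - u : dirichletOp.domain) : L2) := by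
      rw [LinearPMap.map_sub, Submodule.coe_sub, smul_sub]
      have : (v : L2) = (R - l.smulRight (expAbsL2 hκ)) (dirichletOp u - z ^ 2 • (u : L2)) := rfl
      rw [this]
      rw [sub_eq_iff_eq_add] at he
      rw [he]
      abel
    have := dirichlet_injective hκ hz (v - u) h0
    rw [Submodule.coe_sub, sub_eq_zero] at this
    exact this
  · obtain ⟨F, F', hF, hu, h1, h2⟩ := hrep f
    have hF0 : F 0 = l f := hl f F hF.continuous hu
    refine ⟨fun x => F x - l f * expAbs κ x,
        hF.continuous.sub (continuous_const.mul (continuous_expAbs κ)), ?_, fun x => ?_, ?_, ?_⟩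
    · rw [hRD]
      filter_upwards [Lp.coeFn_sub (R f) (l f • expAbsL2 hκ), Lp.coeFn_smul (l f) (expAbsL2 hκ),
        hu, coe_expAbsL2 hκ] with x h1 h2 h3 h4
      rw [h1, Pi.sub_apply, h2, Pi.smul_apply, h3, h4, smul_eq_mul]
    · have hp : IsPrimitive (fun x => F x - l f * expAbs κ x)
          (G f - l f • expAbsDerivL2 hκ : L2) := by
        refine (hF.sub ((isPrimitive_expAbs hκ).const_mul (l f))).congr_ae ?_
        filter_upwards [Lp.coeFn_sub (G f) (l f • expAbsDerivL2 hκ),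
          Lp.coeFn_smul (l f) (expAbsDerivL2 hκ), coe_expAbsDerivL2 hκ] with x h1 h2 h3
        rw [h1, Pi.sub_apply, h2, Pi.smul_apply, h3, smul_eq_mul]
      have hb := norm_sub_le_of_isPrimitive hp x
      have hz0 : F 0 - l f * expAbs κ 0 = 0 := by rw [expAbs_zero, hF0, mul_one, sub_self]
      rw [hz0, sub_zero] at hb
      have hn : ‖G f - l f • expAbsDerivL2 hκ‖ ≤ (‖G‖ + ‖l‖ * ‖expAbsDerivL2 hκ‖) * ‖f‖ := by
        refine (norm_sub_le _ _).trans ?_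
        rw [norm_smul, add_mul]
        refine add_le_add (G.le_opNorm f) ?_
        calc ‖l f‖ * ‖expAbsDerivL2 hκ‖ ≤ ‖l‖ * ‖f‖ * ‖expAbsDerivL2 hκ‖ := by
              gcongr; exact l.le_opNorm f
          _ = _ := by ring
      calc _ ≤ √|x| * ((‖G‖ + ‖l‖ * ‖expAbsDerivL2 hκ‖) * ‖f‖) :=
            hb.trans (mul_le_mul_of_nonneg_left hn (Real.sqrt_nonneg _))
        _ = _ := by ring
    · exact ⟨_, (h1.sub_const_mul (isHalfLineSol_expAbs hκ) (l f)).congr_rhs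
        (Eventually.of_forall fun x _ => by simp)⟩
    · simp only [expAbs_neg]
      exact ⟨_, (h2.sub_const_mul (isHalfLineSol_expAbs hκ) (l f)).congr_rhs
        (f₁ := fun x => f (-x)) (Eventually.of_forall fun x _ => by simp)⟩

/-! ### Zero-energy solutions as power series in the coupling -/

/-- The iterates in the expansion of the solution of `W'' = -l q W`, `W = 1` near `+∞`, in
powers of `-l`, together with their derivatives. -/
noncomputable def zeroEnergySeq (q : ℝ → ℝ) : ℕ → (ℝ → ℝ) × (ℝ → ℝ)
  | 0 => (fun _ => 1, fun _ => 0)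
  | n + 1 => (fun x => ∫ t in (1 : ℝ)..x, ∫ s in (1 : ℝ)..t, q s * (zeroEnergySeq q n).1 s,
      fun x => ∫ s in (1 : ℝ)..x, q s * (zeroEnergySeq q n).1 s)

/-- The second derivatives of the iterates. -/
noncomputable def zeroEnergySeqDeriv (q : ℝ → ℝ) : ℕ → ℝ → ℝ
  | 0 => fun _ => 0
  | n + 1 => fun x => q x * (zeroEnergySeq q n).1 x

section

variable {q : ℝ → ℝ}

theorem zeroEnergySeq_hasDerivAt (hq : Continuous q) (n : ℕ) :
    (∀ x, HasDerivAt (zeroEnergySeq q n).1 ((zeroEnergySeq q n).2 x) x) ∧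
      ∀ x, HasDerivAt (zeroEnergySeq q n).2 (zeroEnergySeqDeriv q n x) x := by
  induction n with
  | zero => exact ⟨fun x => hasDerivAt_const x 1, fun x => hasDerivAt_const x 0⟩
  | succ n ih =>
    have h1 : Continuous (zeroEnergySeq q n).1 :=
      continuous_iff_continuousAt.2 fun x => (ih.1 x).continuousAt
    have h2 : ∀ x, HasDerivAt (zeroEnergySeq q (n + 1)).2 (zeroEnergySeqDeriv q (n + 1) x) x :=
      fun x => ((hq.mul h1).integral_hasStrictDerivAt 1 x).hasDerivAt
    have h3 : Continuous (zeroEnergySeq q (n + 1)).2 :=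
      continuous_iff_continuousAt.2 fun x => (h2 x).continuousAt
    exact ⟨fun x => (h3.integral_hasStrictDerivAt 1 x).hasDerivAt, h2⟩

/-- In the weight $e^{m|x-1|}$ each integration from $1$ gains a factor $1/m$ on both sides of the
base point. -/
theorem abs_integral_le_exp {f : ℝ → ℝ} {A m : ℝ} (hm : 0 < m) (hA : 0 ≤ A)
    (h : ∀ x, |f x| ≤ A * Real.exp (m * |x - 1|)) (x : ℝ) :
    |∫ t in (1 : ℝ)..x, f t| ≤ A / m * Real.exp (m * |x - 1|) := by
  have hd : ∀ c : ℝ, c ≠ 0 → ∀ a b : ℝ, ∫ t in a..b, A * Real.exp (c * (t - 1)) =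
      A / c * Real.exp (c * (b - 1)) - A / c * Real.exp (c * (a - 1)) := by
    intro c hc a b
    apply intervalIntegral.integral_eq_sub_of_hasDerivAt
    · intro t _
      have := ((((hasDerivAt_id t).sub_const 1).const_mul c).exp).const_mul (A / c)
      refine this.congr_deriv ?_
      simp only [id_eq]
      field_simp
    · exact Continuous.intervalIntegrable (by fun_prop) _ _
  rcases le_total 1 x with hx | hx
  · have := intervalIntegral.norm_integral_le_of_norm_le (f := f) (μ := volume)
      (g := fun t => A * Real.exp (m * (t - 1))) hx
      (Eventually.of_forall fun t ht => by
        have := h t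
        rwa [abs_of_pos (sub_pos.2 ht.1)] at this)
      (Continuous.intervalIntegrable (by fun_prop) _ _)
    rw [hd m hm.ne', Real.norm_eq_abs] at this
    rw [abs_of_nonneg (sub_nonneg.2 hx)]
    have h0 : 0 ≤ A / m * Real.exp (m * (1 - 1)) := by positivity
    linarith
  · have := intervalIntegral.norm_integral_le_of_norm_le (f := f) (μ := volume)
      (g := fun t => A * Real.exp (-m * (t - 1))) hx
      (Eventually.of_forall fun t ht => by
        have := h t
        rwa [abs_of_nonpos (sub_nonpos.2 ht.2), mul_neg, ← neg_mul] at this)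
      (Continuous.intervalIntegrable (by fun_prop) _ _)
    rw [hd (-m) (neg_ne_zero.2 hm.ne'), Real.norm_eq_abs] at this
    rw [intervalIntegral.integral_symm, abs_neg, abs_of_nonpos (sub_nonpos.2 hx), mul_neg,
      ← neg_mul]
    have h0 : 0 ≤ A / m * Real.exp (-m * (1 - 1)) := by positivity
    rw [div_neg] at this
    linarith

/-- Each iteration integrates twice and so gains $B/m^2$. Since $m$ is free, the series in powers of
$-l$ can be made geometric on any bounded set of parameters. -/
theorem abs_zeroEnergySeq_le {B m : ℝ} (hB : ∀ x, |q x| ≤ B) (hm : 1 ≤ m) (n : ℕ) (x : ℝ) :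
    |(zeroEnergySeq q n).1 x| ≤ (B / m ^ 2) ^ n * Real.exp (m * |x - 1|) ∧
      |(zeroEnergySeq q n).2 x| ≤ (B / m ^ 2) ^ n * m * Real.exp (m * |x - 1|) ∧
      |zeroEnergySeqDeriv q n x| ≤ (B / m ^ 2) ^ n * m ^ 2 * Real.exp (m * |x - 1|) := by
  have hB0 : 0 ≤ B := (abs_nonneg _).trans (hB 0)
  have hm0 : 0 < m := by linarith
  induction n generalizing x with
  | zero =>
    refine ⟨?_, ?_, ?_⟩
    · simp only [zeroEnergySeq, abs_one, pow_zero, one_mul]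
      exact Real.one_le_exp (by positivity)
    · simp only [zeroEnergySeq, abs_zero]; positivity
    · simp only [zeroEnergySeqDeriv, abs_zero]; positivity
  | succ n ih =>
    have e : ∀ x, |q x * (zeroEnergySeq q n).1 x| ≤
        (B / m ^ 2) ^ (n + 1) * m ^ 2 * Real.exp (m * |x - 1|) := by
      intro x
      rw [abs_mul]
      calc _ ≤ B * ((B / m ^ 2) ^ n * Real.exp (m * |x - 1|)) :=
            mul_le_mul (hB x) (ih x).1 (abs_nonneg _) hB0
        _ = _ := by
          have hBm : B = B / m ^ 2 * m ^ 2 := by field_simp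
          rw [pow_succ]
          linear_combination ((B / m ^ 2) ^ n * Real.exp (m * |x - 1|)) * hBm
    have e2 : ∀ x, |(zeroEnergySeq q (n + 1)).2 x| ≤
        (B / m ^ 2) ^ (n + 1) * m * Real.exp (m * |x - 1|) := by
      intro x
      refine (abs_integral_le_exp hm0 (by positivity) e x).trans (le_of_eq ?_)
      field_simp
    refine ⟨?_, e2 x, e x⟩
    refine (abs_integral_le_exp hm0 (by positivity) e2 x).trans (le_of_eq ?_)
    field_simp

theorem zeroEnergySeq_eq_zero (h1 : ∀ x, 1 ≤ x → q x = 0) (n : ℕ) {x : ℝ} (hx : 1 ≤ x) :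
    (zeroEnergySeq q (n + 1)).1 x = 0 ∧ (zeroEnergySeq q n).2 x = 0 := by
  have h : ∀ n x, 1 ≤ x → (zeroEnergySeq q n).2 x = 0 := by
    intro n x hx
    cases n with
    | zero => rfl
    | succ n =>
      refine (intervalIntegral.integral_congr (g := fun _ => 0) fun t ht => ?_).trans (by simp)
      rw [uIcc_of_le hx] at ht
      simp [h1 t ht.1]
  refine ⟨?_, h n x hx⟩
  refine (intervalIntegral.integral_congr (g := fun _ => 0) fun t ht => ?_).trans (by simp)
  rw [uIcc_of_le hx] at ht
  exact h (n + 1) t ht.1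

theorem abs_pow_mul_le {B Λ m a l c : ℝ} {n : ℕ} (hB : 0 ≤ B) (hl : |l| ≤ Λ) (hm : 1 ≤ m)
    (hmB : Λ * B / m ^ 2 ≤ 1 / 2) (hc : 0 ≤ c) (ha : |a| ≤ (B / m ^ 2) ^ n * c) :
    ‖(-l) ^ n * a‖ ≤ (1 / 2) ^ n * c := by
  rw [Real.norm_eq_abs, abs_mul, abs_pow, abs_neg]
  calc |l| ^ n * |a| ≤ Λ ^ n * ((B / m ^ 2) ^ n * c) := by
        gcongr
        exact pow_nonneg ((abs_nonneg l).trans hl) n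
    _ = (Λ * B / m ^ 2) ^ n * c := by rw [← mul_assoc, ← mul_pow, mul_div_assoc]
    _ ≤ _ := by
      have : 0 ≤ Λ * B / m ^ 2 := by
        have := (abs_nonneg l).trans hl
        positivity
      gcongr

/-- Solutions of `W'' = -l q W` equal to `1` near `+∞`, depending continuously on `l`. -/
theorem exists_zeroEnergySol (hq : Continuous q) {B : ℝ} (hB : ∀ x, |q x| ≤ B)
    (h1 : ∀ x, 1 ≤ x → q x = 0) : ∃ W W' : ℝ → ℝ → ℝ, Continuous (Function.uncurry W) ∧
      (∀ l x, HasDerivAt (W l) (W' l x) x) ∧ (∀ l x, HasDerivAt (W' l) (-l * q x * W l x) x) ∧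
      ∀ l x, 1 ≤ x → W l x = 1 ∧ W' l x = 0 := by
  have hB0 : 0 ≤ B := (abs_nonneg _).trans (hB 0)
  -- a common summable bound on bounded sets of parameters
  have key : ∀ L R : ℝ, ∃ u : ℕ → ℝ, Summable u ∧ ∀ n l x, |l| < L → |x| < R →
      ‖(-l) ^ n * (zeroEnergySeq q n).1 x‖ ≤ u n ∧ ‖(-l) ^ n * (zeroEnergySeq q n).2 x‖ ≤ u n ∧
      ‖(-l) ^ n * zeroEnergySeqDeriv q n x‖ ≤ u n := by
    intro L R
    -- Chosen so that $|L|B/m^2\le\frac12$, using $m\le m^2$.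
    set m := 1 + 2 * |L| * B with hm
    have hm1 : 1 ≤ m := by rw [hm]; nlinarith [abs_nonneg L, mul_nonneg (abs_nonneg L) hB0]
    have hmB : |L| * B / m ^ 2 ≤ 1 / 2 := by
      rw [div_le_iff₀ (by positivity)]
      nlinarith [mul_nonneg (abs_nonneg L) hB0]
    refine ⟨fun n => (1 / 2) ^ n * (m ^ 2 * Real.exp (m * (R + 1))),
      (summable_geometric_two).mul_right _, fun n l x hl hx => ?_⟩
    have hl' : |l| ≤ |L| := hl.le.trans (le_abs_self L)
    have he : Real.exp (m * |x - 1|) ≤ Real.exp (m * (R + 1)) := by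
      have : |x - 1| ≤ R + 1 := by
        have := abs_sub x 1
        rw [abs_one] at this
        linarith
      gcongr
    have hp : 0 ≤ (B / m ^ 2) ^ n := by positivity
    have hm2 : m ≤ m ^ 2 := by nlinarith
    obtain ⟨b1, b2, b3⟩ := abs_zeroEnergySeq_le hB hm1 n x
    refine ⟨?_, ?_, ?_⟩ <;> apply abs_pow_mul_le hB0 hl' hm1 hmB (by positivity)
    · refine b1.trans (mul_le_mul_of_nonneg_left ?_ hp)
      nlinarith [Real.exp_pos (m * |x - 1|), Real.exp_pos (m * (R + 1))]
    · refine b2.trans ?_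
      rw [mul_assoc]
      gcongr
    · refine b3.trans ?_
      rw [mul_assoc]
      gcongr
  have hsum : ∀ l x, Summable (fun n => (-l) ^ n * (zeroEnergySeq q n).1 x) ∧
      Summable (fun n => (-l) ^ n * (zeroEnergySeq q n).2 x) := by
    intro l x
    obtain ⟨u, hu, hb⟩ := key (|l| + 1) (|x| + 1)
    exact ⟨hu.of_norm_bounded fun n => (hb n l x (lt_add_one _) (lt_add_one _)).1,
      hu.of_norm_bounded fun n => (hb n l x (lt_add_one _) (lt_add_one _)).2.1⟩
  have hball : ∀ R : ℝ, ∀ y ∈ Metric.ball (0 : ℝ) R, |y| < R := fun R y hy => by simpa using hy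
  refine ⟨fun l x => ∑' n, (-l) ^ n * (zeroEnergySeq q n).1 x,
    fun l x => ∑' n, (-l) ^ n * (zeroEnergySeq q n).2 x, ?_, fun l x => ?_, fun l x => ?_,
    fun l x hx => ⟨?_, ?_⟩⟩
  · rw [continuous_iff_continuousAt]
    rintro ⟨l, x⟩
    obtain ⟨u, hu, hb⟩ := key (|l| + 1) (|x| + 1)
    have hc : ContinuousOn (fun p : ℝ × ℝ => ∑' n, (-p.1) ^ n * (zeroEnergySeq q n).1 p.2)
        (Metric.ball (0 : ℝ) (|l| + 1) ×ˢ Metric.ball (0 : ℝ) (|x| + 1)) := by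
      refine continuousOn_tsum (fun n => ?_) hu
        fun n p hp => (hb n p.1 p.2 (hball _ _ hp.1) (hball _ _ hp.2)).1
      have : Continuous (zeroEnergySeq q n).1 :=
        continuous_iff_continuousAt.2 fun x => ((zeroEnergySeq_hasDerivAt hq n).1 x).continuousAt
      exact Continuous.continuousOn (by fun_prop)
    refine hc.continuousAt (prod_mem_nhds ?_ ?_) <;>
      exact Metric.isOpen_ball.mem_nhds (by simp)
  · obtain ⟨u, hu, hb⟩ := key (|l| + 1) (|x| + 1)
    exact hasDerivAt_tsum_of_isPreconnected hu Metric.isOpen_ball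
      (convex_ball (0 : ℝ) (|x| + 1)).isPreconnected
      (fun n y _ => ((zeroEnergySeq_hasDerivAt hq n).1 y).const_mul _)
      (fun n y hy => (hb n l y (lt_add_one _) (hball _ _ hy)).2.1) (y₀ := x) (by simp)
      (hsum l x).1 (by simp)
  · obtain ⟨u, hu, hb⟩ := key (|l| + 1) (|x| + 1)
    have := hasDerivAt_tsum_of_isPreconnected hu Metric.isOpen_ball
      (convex_ball (0 : ℝ) (|x| + 1)).isPreconnected
      (fun n y _ => ((zeroEnergySeq_hasDerivAt hq n).2 y).const_mul ((-l) ^ n))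
      (fun n y hy => (hb n l y (lt_add_one _) (hball _ _ hy)).2.2) (y₀ := x) (by simp)
      (hsum l x).2 (y := x) (by simp)
    refine this.congr_deriv ?_
    have hs : Summable (fun n => (-l) ^ n * zeroEnergySeqDeriv q n x) :=
      hu.of_norm_bounded fun n => (hb n l x (lt_add_one _) (lt_add_one _)).2.2
    -- The constant zeroth term has no second derivative; shifting the index brings out the factor
    -- $-l\,q$.
    rw [hs.tsum_eq_zero_add, ← tsum_mul_left]
    simp only [zeroEnergySeqDeriv, mul_zero, zero_add]
    refine tsum_congr fun n => ?_
    ring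
  · beta_reduce
    rw [tsum_eq_single 0]
    · simp [zeroEnergySeq]
    · rintro (_ | n) hn
      · exact absurd rfl hn
      · rw [(zeroEnergySeq_eq_zero h1 n hx).1, mul_zero]
  · simp [(zeroEnergySeq_eq_zero h1 _ hx).2]

end

/-! ### The zero-energy equation: uniqueness, Wronskians, behaviour off the support -/

/-- `ψ` is a solution of `ψ'' = -l q ψ` with derivative `ψ'`. -/
structure IsZeroSol (l : ℝ) (q ψ ψ' : ℝ → ℝ) : Prop where
  hasDerivAt : ∀ x, HasDerivAt ψ (ψ' x) x
  hasDerivAt' : ∀ x, HasDerivAt ψ' (-l * q x * ψ x) x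

namespace IsZeroSol

variable {l m : ℝ} {q ψ ψ' φ φ' : ℝ → ℝ}

theorem continuous (h : IsZeroSol l q ψ ψ') : Continuous ψ :=
  continuous_iff_continuousAt.2 fun x => (h.hasDerivAt x).continuousAt

theorem continuous' (h : IsZeroSol l q ψ ψ') : Continuous ψ' :=
  continuous_iff_continuousAt.2 fun x => (h.hasDerivAt' x).continuousAt

theorem comp_neg (h : IsZeroSol l q ψ ψ') :
    IsZeroSol l (fun x => q (-x)) (fun x => ψ (-x)) (fun x => -ψ' (-x)) := by
  refine ⟨fun x => ?_, fun x => ?_⟩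
  · have := (h.hasDerivAt (-x)).comp x (hasDerivAt_neg x)
    exact this.congr_deriv (by ring)
  · have := ((h.hasDerivAt' (-x)).comp x (hasDerivAt_neg x)).neg
    exact this.congr_deriv (by ring)

theorem const_mul (h : IsZeroSol l q ψ ψ') (c : ℝ) :
    IsZeroSol l q (fun x => c * ψ x) (fun x => c * ψ' x) :=
  ⟨fun x => (h.hasDerivAt x).const_mul c,
    fun x => ((h.hasDerivAt' x).const_mul c).congr_deriv (by ring)⟩

theorem unique (h : IsZeroSol l q ψ ψ') (h' : IsZeroSol l q φ φ') {B : ℝ} (hB : ∀ x, |q x| ≤ B)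
    {a : ℝ} (h0 : ψ a = φ a) (h1 : ψ' a = φ' a) : ψ = φ ∧ ψ' = φ' := by
  have hK : ∀ t, LipschitzOnWith (Real.toNNReal (1 + |l| * B))
      (fun p : ℝ × ℝ => (p.2, -l * q t * p.1)) univ := by
    intro t
    refine LipschitzOnWith.of_dist_le_mul fun p _ r _ => ?_
    have hB0 : 0 ≤ B := (abs_nonneg _).trans (hB 0)
    rw [Real.coe_toNNReal _ (by positivity), Prod.dist_eq, Prod.dist_eq]
    have hmax : 0 ≤ max (dist p.1 r.1) (dist p.2 r.2) := le_max_of_le_left dist_nonneg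
    refine max_le ?_ ?_
    · refine (le_max_right _ _).trans (le_mul_of_one_le_left hmax ?_)
      have : 0 ≤ |l| * B := by positivity
      linarith
    · rw [Real.dist_eq, ← mul_sub, abs_mul, abs_mul, abs_neg]
      refine mul_le_mul ?_ ((Real.dist_eq p.1 r.1).symm.le.trans (le_max_left _ _))
        (abs_nonneg _) (by positivity)
      have := mul_le_mul_of_nonneg_left (hB t) (abs_nonneg l)
      linarith
  have := ODE_solution_unique_univ (v := fun t (p : ℝ × ℝ) => (p.2, -l * q t * p.1))
    (s := fun _ => univ) (f := fun x => (ψ x, ψ' x)) (g := fun x => (φ x, φ' x)) (t₀ := a) hK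
    (fun t => ⟨(h.hasDerivAt t).prodMk (h.hasDerivAt' t), trivial⟩)
    (fun t => ⟨(h'.hasDerivAt t).prodMk (h'.hasDerivAt' t), trivial⟩) (by rw [h0, h1])
  exact ⟨funext fun x => congrArg Prod.fst (congrFun this x),
    funext fun x => congrArg Prod.snd (congrFun this x)⟩

/-- For different parameters this gives orthogonality in the weight $q$; for equal ones, constancy
of the Wronskian. -/
theorem hasDerivAt_wronskian (h : IsZeroSol l q ψ ψ') (h' : IsZeroSol m q φ φ') (x : ℝ) :
    HasDerivAt (fun x => ψ' x * φ x - ψ x * φ' x) ((m - l) * (q x * (ψ x * φ x))) x := by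
  have := ((h.hasDerivAt' x).mul (h'.hasDerivAt x)).sub ((h.hasDerivAt x).mul (h'.hasDerivAt' x))
  exact this.congr_deriv (by ring)

theorem eqOn_deriv (h : IsZeroSol l q ψ ψ') {a : ℝ} (hq : ∀ x, a ≤ x → q x = 0) {x : ℝ}
    (hx : a ≤ x) : ψ' x = ψ' a := by
  have := intervalIntegral.integral_eq_sub_of_hasDerivAt (a := a) (b := x)
    (f := ψ') (f' := fun _ => 0) (fun t ht => by
      rw [uIcc_of_le hx] at ht
      have := h.hasDerivAt' t
      rwa [hq t ht.1, mul_zero, zero_mul] at this) (by simp)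
  simp at this
  linarith

/-- A bounded solution has zero slope where the potential vanishes. -/
theorem deriv_eq_zero (h : IsZeroSol l q ψ ψ') {a : ℝ} (hq : ∀ x, a ≤ x → q x = 0) {C : ℝ}
    (hC : ∀ x, |ψ x| ≤ C) {x : ℝ} (hx : a ≤ x) : ψ' x = 0 := by
  rw [h.eqOn_deriv hq hx]
  by_contra hne
  have hlin : ∀ y, a ≤ y → ψ y - ψ a = ψ' a * (y - a) := by
    intro y hy
    have := intervalIntegral.integral_eq_sub_of_hasDerivAt (a := a) (b := y)
      (f := ψ) (f' := fun _ => ψ' a) (fun t ht => by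
        rw [uIcc_of_le hy] at ht
        have := h.hasDerivAt t
        rwa [h.eqOn_deriv hq ht.1] at this) (by simp)
    simp at this
    linarith
  have hpos : 0 < |ψ' a| := abs_pos.2 hne
  have hC0 : 0 ≤ C := (abs_nonneg _).trans (hC 0)
  -- At this distance an affine function with slope $\psi'(a)$ has changed by $2C+1$, more than two
  -- values bounded by $C$ can differ.
  have h1 := hlin (a + (2 * C + 1) / |ψ' a|) (by
    have : 0 ≤ (2 * C + 1) / |ψ' a| := by positivity
    linarith)
  have h2 : |ψ (a + (2 * C + 1) / |ψ' a|) - ψ a| = 2 * C + 1 := by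
    rw [h1, add_sub_cancel_left, abs_mul, abs_div, abs_abs, abs_of_nonneg (by positivity : 0 ≤ 2 * C + 1)]
    field_simp
  have h3 := abs_sub (ψ (a + (2 * C + 1) / |ψ' a|)) (ψ a)
  linarith [hC (a + (2 * C + 1) / |ψ' a|), hC a]

end IsZeroSol

/-! ### Finiteness of the set of resonant angles -/

namespace CurvatureProfile

variable (p : CurvatureProfile)

theorem k_eq_zero {x : ℝ} (hx : 1 ≤ |x|) : p.k x = 0 := by
  apply image_eq_zero_of_notMem_tsupport
  exact fun h => absurd (abs_lt.2 (p.supp h)) (not_lt.2 hx)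

theorem exists_k_ne_zero : ∃ x, p.k x ≠ 0 := by
  by_contra! h
  have := p.integral_eq
  simp [h] at this

theorem exists_bound : ∃ B, ∀ x, |p.k x ^ 2| ≤ B := by
  obtain ⟨C, hC⟩ := p.hasCompactSupport.exists_bound_of_continuous p.smooth.continuous
  refine ⟨C ^ 2, fun x => ?_⟩
  rw [abs_pow]
  exact pow_le_pow_left₀ (abs_nonneg _) (hC x) 2

/-- Solutions of `ψ'' = -(ϑ² k² / 4) ψ`. -/
theorem resonance_iff (ϑ : ℝ) : ZeroEnergyResonance p ϑ ↔ ∃ ψ ψ' : ℝ → ℝ,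
    IsZeroSol (ϑ ^ 2 / 4) (fun x => p.k x ^ 2) ψ ψ' ∧ (∃ s, ψ s ≠ 0) ∧ ∃ C, ∀ s, |ψ s| ≤ C := by
  constructor
  · rintro ⟨ψ, h2, hne, hb, he⟩
    have h2' : ContDiff ℝ (1 + 1) ψ := h2
    have hd : ContDiff ℝ 1 (deriv ψ) := (contDiff_succ_iff_deriv.1 h2').2.2
    refine ⟨ψ, deriv ψ, ⟨fun x => (h2.differentiable (by simp) x).hasDerivAt, fun x => ?_⟩, hne, hb⟩
    refine (hd.differentiable (by simp) x).hasDerivAt.congr_deriv ?_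
    linear_combination -2 * he x
  · rintro ⟨ψ, ψ', h, hne, hb⟩
    have e1 : deriv ψ = ψ' := funext fun x => (h.hasDerivAt x).deriv
    have e2 : deriv ψ' = fun x => -(ϑ ^ 2 / 4) * p.k x ^ 2 * ψ x :=
      funext fun x => (h.hasDerivAt' x).deriv
    refine ⟨ψ, ?_, hne, hb, fun s => ?_⟩
    · have h1 : ContDiff ℝ 1 ψ' := by
        rw [contDiff_one_iff_deriv]
        refine ⟨fun x => (h.hasDerivAt' x).differentiableAt, ?_⟩
        rw [e2]
        have := p.smooth.continuous
        have := h.continuous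
        fun_prop
      have : ContDiff ℝ (1 + 1) ψ := by
        rw [contDiff_succ_iff_deriv, e1]
        exact ⟨fun x => (h.hasDerivAt x).differentiableAt, by simp, h1⟩
      exact this
    · rw [e1, e2]
      ring

/-- The solution equal to `1` on the right half-line. -/
theorem exists_right_sol : ∃ W W' : ℝ → ℝ → ℝ, Continuous (Function.uncurry W) ∧
    (∀ l, IsZeroSol l (fun x => p.k x ^ 2) (W l) (W' l)) ∧
      ∀ l x, 1 ≤ x → W l x = 1 ∧ W' l x = 0 := by
  obtain ⟨B, hB⟩ := p.exists_bound
  obtain ⟨W, W', h1, h2, h3, h4⟩ := exists_zeroEnergySol (q := fun x => p.k x ^ 2)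
    (p.smooth.continuous.pow 2) hB (fun x hx => by
      simp only [p.k_eq_zero (hx.trans (le_abs_self x))]; norm_num)
  exact ⟨W, W', h1, fun l => ⟨h2 l, h3 l⟩, h4⟩

/-- If there is a nontrivial bounded solution, then the one equal to `1` on the right has zero
slope on the left. -/
theorem deriv_eq_zero_of_bounded_sol {ψ ψ' W W' : ℝ → ℝ} {l : ℝ}
    (h : IsZeroSol l (fun x => p.k x ^ 2) ψ ψ') (hne : ∃ s, ψ s ≠ 0) {C : ℝ}
    (hC : ∀ s, |ψ s| ≤ C) (hW : IsZeroSol l (fun x => p.k x ^ 2) W W')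
    (h1 : W 1 = 1) (h1' : W' 1 = 0) : W' (-1) = 0 := by
  obtain ⟨B, hB⟩ := p.exists_bound
  have hr : ψ' 1 = 0 := h.deriv_eq_zero (a := 1) (fun x hx => by
    rw [p.k_eq_zero (hx.trans (le_abs_self x))]; norm_num) hC le_rfl
  have hl : -ψ' (-1) = 0 := h.comp_neg.deriv_eq_zero (a := 1) (fun x hx => by
    rw [p.k_eq_zero (hx.trans ((le_abs_self x).trans (abs_neg x).symm.le))]; norm_num)
      (fun x => hC (-x)) le_rfl
  -- A bounded solution has zero slope at $1$, so it is the multiple $\psi(1)$ of $W$, and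
  -- $\psi(1)\ne0$.
  obtain ⟨e1, e2⟩ := h.unique (hW.const_mul (ψ 1)) hB (a := 1) (by rw [h1, mul_one])
    (by rw [h1', mul_zero, hr])
  have h0 : ψ 1 ≠ 0 := by
    intro h0
    obtain ⟨s, hs⟩ := hne
    have := congrFun e1 s
    simp only [h0, zero_mul] at this
    exact hs this
  have := congrFun e2 (-1)
  rw [neg_eq_zero.1 hl] at this
  exact (mul_eq_zero.1 this.symm).resolve_left h0

/-- Only finitely many angles are resonant. -/
theorem finite_resonances {b : ℝ} :
    {ϑ : ℝ | ϑ ∈ Ioo (0 : ℝ) b ∧ ZeroEnergyResonance p ϑ}.Finite := by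
  obtain ⟨W, W', hc, hW, h1⟩ := p.exists_right_sol
  obtain ⟨B, hB⟩ := p.exists_bound
  -- The pairing of $W_l$ and $W_m$ in the weight $k^2$: continuous, positive on the diagonal, and
  -- zero at pairs of distinct Neumann parameters.
  set Φ : ℝ × ℝ → ℝ := fun a => ∫ x in (-1 : ℝ)..1, p.k x ^ 2 * (W a.1 x * W a.2 x) with hΦ
  have hk := p.smooth.continuous
  have hΦc : Continuous Φ := by
    apply intervalIntegral.continuous_parametric_intervalIntegral_of_continuous'
    have c1 : Continuous fun y : (ℝ × ℝ) × ℝ => W y.1.1 y.2 :=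
      hc.comp (f := fun y : (ℝ × ℝ) × ℝ => (y.1.1, y.2)) (by fun_prop)
    have c2 : Continuous fun y : (ℝ × ℝ) × ℝ => W y.1.2 y.2 :=
      hc.comp (f := fun y : (ℝ × ℝ) × ℝ => (y.1.2, y.2)) (by fun_prop)
    simp only [Function.uncurry_def]
    fun_prop
  have horth : ∀ l m, W' l (-1) = 0 → W' m (-1) = 0 → l ≠ m → Φ (l, m) = 0 := by
    intro l m hl hm hne
    have := intervalIntegral.integral_eq_sub_of_hasDerivAt (a := -1) (b := 1)
      (fun x _ => (hW l).hasDerivAt_wronskian (hW m) x) (by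
        have := (hW l).continuous
        have := (hW m).continuous
        exact Continuous.intervalIntegrable (by fun_prop) _ _)
    rw [intervalIntegral.integral_const_mul, hl, hm, (h1 l 1 le_rfl).2, (h1 m 1 le_rfl).2] at this
    simp only [zero_mul, mul_zero, sub_self] at this
    exact (mul_eq_zero.1 this).resolve_left (sub_ne_zero.2 hne.symm)
  have hpos : ∀ l, 0 < Φ (l, l) := by
    intro l
    have hcont : Continuous fun x => p.k x ^ 2 * (W l x * W l x) := by
      have := (hW l).continuous
      fun_prop
    have hnn : ∀ x, 0 ≤ p.k x ^ 2 * (W l x * W l x) := fun x =>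
      mul_nonneg (sq_nonneg _) (mul_self_nonneg _)
    obtain ⟨x, hx⟩ : ∃ x ∈ Icc (-1 : ℝ) 1, 0 < p.k x ^ 2 * (W l x * W l x) := by
      by_contra! hcon
      have h0 : ∀ x, p.k x ^ 2 * W l x = 0 := by
        intro x
        by_cases hx : x ∈ Icc (-1 : ℝ) 1
        · have := le_antisymm (hcon x hx) (hnn x)
          rcases mul_eq_zero.1 this with h | h
          · rw [h, zero_mul]
          · rw [mul_self_eq_zero.1 h, mul_zero]
        · rw [p.k_eq_zero (le_of_not_ge fun h => hx (abs_le.1 h))]; norm_num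
      -- If $k^2W_l$ vanishes identically, then $W_l$ also solves the equation with zero coupling,
      -- so $W_l=1$ and $k=0$, against $\int k=1$.
      have h2 : IsZeroSol 0 (fun x => p.k x ^ 2) (W l) (W' l) :=
        ⟨(hW l).hasDerivAt, fun x => ((hW l).hasDerivAt' x).congr_deriv (by
          rw [mul_assoc, h0 x]; ring)⟩
      have h3 : IsZeroSol 0 (fun x => p.k x ^ 2) (fun _ => 1) (fun _ => 0) :=
        ⟨fun x => hasDerivAt_const x 1, fun x => (hasDerivAt_const x 0).congr_deriv (by ring)⟩
      have h4 := (h2.unique h3 hB (a := 1) (h1 l 1 le_rfl).1 (h1 l 1 le_rfl).2).1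
      obtain ⟨x, hx⟩ := p.exists_k_ne_zero
      have := h0 x
      rw [h4, mul_one] at this
      exact hx (pow_eq_zero_iff two_ne_zero |>.1 this)
    exact intervalIntegral.integral_pos (by norm_num) hcont.continuousOn
      (fun y _ => hnn y) ⟨x, hx.1, hx.2⟩
  have hres : ∀ ϑ, ZeroEnergyResonance p ϑ → W' (ϑ ^ 2 / 4) (-1) = 0 := by
    intro ϑ h
    obtain ⟨ψ, ψ', h, hne, C, hC⟩ := (p.resonance_iff ϑ).1 h
    exact p.deriv_eq_zero_of_bounded_sol h hne hC (hW _) (h1 _ 1 le_rfl).1 (h1 _ 1 le_rfl).2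
  set S := {ϑ : ℝ | ϑ ∈ Ioo (0 : ℝ) b ∧ ZeroEnergyResonance p ϑ} with hS
  have hfin : (Icc 0 b ∩ S).Finite := by
    refine isCompact_Icc.induction_on (p := fun t => (t ∩ S).Finite) (by simp)
      (fun s t hst ht => ht.subset (inter_subset_inter_left S hst))
      (fun s t hs ht => by rw [union_inter_distrib_right]; exact hs.union ht) fun ϑ _ => ?_
    have hcont : Continuous fun a : ℝ × ℝ => Φ (a.1 ^ 2 / 4, a.2 ^ 2 / 4) :=
      hΦc.comp (by fun_prop)
    -- Positivity persists near the diagonal point, so some neighbourhood of $\vartheta$ contains at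
    -- most one resonant angle: two would be orthogonal.
    have hev : ∀ᶠ a in 𝓝 (ϑ, ϑ), 0 < Φ (a.1 ^ 2 / 4, a.2 ^ 2 / 4) :=
      hcont.continuousAt.eventually (lt_mem_nhds (hpos _))
    rw [nhds_prod_eq, eventually_prod_self_iff'] at hev
    obtain ⟨t, ht, hts⟩ := hev
    refine ⟨t, mem_nhdsWithin_of_mem_nhds ht, Set.Subsingleton.finite ?_⟩
    rintro α ⟨hαt, hα0, hα⟩ β ⟨hβt, hβ0, hβ⟩
    by_contra hne
    refine (hts α hαt β hβt).ne' (horth _ _ (hres α hα) (hres β hβ) fun h => hne ?_)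
    have : α ^ 2 = β ^ 2 := by linarith
    exact (pow_left_inj₀ hα0.1.le hβ0.1.le two_ne_zero).1 this
  exact hfin.subset fun ϑ h => ⟨Ioo_subset_Icc_self h.1, h⟩

end CurvatureProfile

/-! ### Absence of resonances for small profiles -/

/-- A solution on a short interval with a Dirichlet and a Neumann end vanishes. -/
theorem IsZeroSol.deriv_eq_zero_of_short {l a b : ℝ} {q ψ ψ' : ℝ → ℝ} (h : IsZeroSol l q ψ ψ')
    (hl : 0 ≤ l) (hq : ∀ x, |q x| ≤ 1) (hab : a ≤ b) (ha : ψ a = 0) (hb : ψ' b = 0)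
    (hshort : l * (b - a) ^ 2 < 2) : ψ' a = 0 := by
  obtain ⟨x₀, hx₀, hmax⟩ := isCompact_Icc.exists_isMaxOn (nonempty_Icc.2 hab)
    h.continuous.abs.continuousOn
  set M := |ψ x₀| with hM
  have hM0 : 0 ≤ M := abs_nonneg _
  have hψ : ∀ x ∈ Icc a b, |ψ x| ≤ M := fun x hx => hmax hx
  have hψ' : ∀ x ∈ Icc a b, |ψ' x| ≤ l * M * (b - x) := by
    intro x hx
    have := Convex.norm_image_sub_le_of_norm_hasDerivWithin_le (s := Icc a b) (C := l * M)
      (fun t ht => (h.hasDerivAt' t).hasDerivWithinAt) (fun t ht => by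
        rw [Real.norm_eq_abs, abs_mul, abs_mul, abs_neg, abs_of_nonneg hl]
        exact mul_le_mul (mul_le_of_le_one_right hl (hq t)) (hψ t ht) (abs_nonneg _) hl)
      (convex_Icc a b) (right_mem_Icc.2 hab) hx
    rwa [hb, sub_zero, Real.norm_eq_abs, Real.norm_eq_abs, abs_sub_comm,
      abs_of_nonneg (sub_nonneg.2 hx.2)] at this
  have e1 : ∫ x in a..x₀, ψ' x = ψ x₀ := by
    rw [intervalIntegral.integral_eq_sub_of_hasDerivAt (fun x _ => h.hasDerivAt x)
      (h.continuous'.intervalIntegrable _ _), ha, sub_zero]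
  have e2 : ∫ x in a..x₀, l * M * (b - x) = l * M * (((b - a) ^ 2 - (b - x₀) ^ 2) / 2) := by
    rw [intervalIntegral.integral_const_mul, intervalIntegral.integral_comp_sub_left (fun x => x),
      integral_id]
  -- Integrating the slope bound from the Dirichlet end to the maximum point gives
  -- $M\le\frac12l(b-a)^2M$, hence $M=0$ by the length condition.
  have hb2 : M ≤ l * M * (((b - a) ^ 2 - (b - x₀) ^ 2) / 2) := by
    calc M = ‖∫ x in a..x₀, ψ' x‖ := by rw [e1, hM, Real.norm_eq_abs]
      _ ≤ ∫ x in a..x₀, l * M * (b - x) :=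
        intervalIntegral.norm_integral_le_of_norm_le hx₀.1
          (Eventually.of_forall fun t ht => hψ' t ⟨ht.1.le, ht.2.trans hx₀.2⟩)
          (Continuous.intervalIntegrable (by fun_prop) _ _)
      _ = _ := e2
  have hM1 : M = 0 := by
    have h1 : 0 ≤ l * M * (b - x₀) ^ 2 := by positivity
    nlinarith
  have := hψ' a (left_mem_Icc.2 hab)
  rw [hM1, mul_zero, zero_mul] at this
  exact abs_nonpos_iff.1 this

/-- A bounded solution has zero slope at $\pm\frac45$. A zero in between is at distance at most
$\frac45$ from the end on its own side, and the short-interval lemma makes it a double zero, so the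
solution vanishes. Without a zero the solution has one sign, while its integral against $k^2$ is
zero. -/
theorem CurvatureProfile.not_resonance (p : CurvatureProfile) (h1 : ∀ s, |p.k s| ≤ 1)
    (h2 : ∀ s, 3 / 4 < |s| → p.k s = 0) {ϑ : ℝ} (hϑ : ϑ ∈ Ioo (0 : ℝ) Real.pi) :
    ¬ ZeroEnergyResonance p ϑ := by
  intro hres
  obtain ⟨ψ, ψ', h, ⟨s, hs⟩, C, hC⟩ := (p.resonance_iff ϑ).1 hres
  obtain ⟨B, hB⟩ := p.exists_bound
  have hq : ∀ x, |p.k x ^ 2| ≤ 1 := fun x => by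
    rw [abs_pow]; exact pow_le_one₀ (abs_nonneg _) (h1 x)
  -- Any end point slightly beyond $\frac34$ would do; it lets the hypothesis with the strict
  -- inequality apply at the end point itself.
  have hq0 : ∀ x : ℝ, 4 / 5 ≤ |x| → p.k x ^ 2 = 0 := fun x hx => by
    rw [h2 x (by linarith)]; norm_num
  have hl : 0 ≤ ϑ ^ 2 / 4 := by positivity
  -- Numerically the left side is below $1.59$, so the crude length condition suffices.
  have hl2 : ϑ ^ 2 / 4 * (4 / 5) ^ 2 < 2 := by
    have := Real.pi_lt_d2
    have : ϑ < 3.15 := hϑ.2.trans this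
    nlinarith [hϑ.1]
  have hr : ψ' (4 / 5) = 0 :=
    h.deriv_eq_zero (a := 4 / 5) (fun x hx => hq0 x (hx.trans (le_abs_self x))) hC le_rfl
  have hl' : -ψ' (-(4 / 5)) = 0 := h.comp_neg.deriv_eq_zero (a := 4 / 5)
    (fun x hx => hq0 (-x) (by rw [abs_neg]; exact hx.trans (le_abs_self x))) (fun x => hC (-x)) le_rfl
  by_cases hz : ∃ a ∈ Icc (-(4 / 5) : ℝ) (4 / 5), ψ a = 0
  · obtain ⟨a, ha, ha0⟩ := hz
    have hd : ψ' a = 0 := by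
      rcases le_total 0 a with h0 | h0
      · refine h.deriv_eq_zero_of_short hl hq ha.2 ha0 hr (lt_of_le_of_lt ?_ hl2)
        exact mul_le_mul_of_nonneg_left (pow_le_pow_left₀ (by linarith [ha.2]) (by linarith) 2) hl
      · refine neg_eq_zero.1 ?_
        have := h.comp_neg.deriv_eq_zero_of_short (a := -a) hl (fun x => hq (-x))
          (b := 4 / 5) (by linarith [ha.1]) (by rwa [neg_neg]) hl' (lt_of_le_of_lt
          (mul_le_mul_of_nonneg_left (pow_le_pow_left₀ (by linarith [ha.1]) (by linarith) 2) hl) hl2)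
        rwa [neg_neg] at this
    have h0 : IsZeroSol (ϑ ^ 2 / 4) (fun x => p.k x ^ 2) (fun _ => 0) (fun _ => 0) :=
      ⟨fun x => hasDerivAt_const x 0, fun x => (hasDerivAt_const x 0).congr_deriv (by ring)⟩
    exact hs (congrFun (h.unique h0 hB ha0 hd).1 s)
  · push Not at hz
    obtain ⟨x, hx⟩ := p.exists_k_ne_zero
    have hxI : x ∈ Icc (-(4 / 5) : ℝ) (4 / 5) := by
      refine abs_le.1 (le_of_not_gt fun hcon => hx ?_)
      exact h2 x (by linarith)
    -- Multiplying by the fixed value $\psi(x)$, at a point with $k(x)\ne0$, avoids distinguishing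
    -- the sign of $\psi$.
    have hsign : ∀ y ∈ Icc (-(4 / 5) : ℝ) (4 / 5), 0 < ψ y * ψ x := by
      intro y hy
      by_contra hcon
      have h0 : (0 : ℝ) ∈ uIcc (ψ y) (ψ x) := by
        rw [mem_uIcc]
        rcases mul_nonpos_iff.1 (not_lt.1 hcon) with h | h
        · exact Or.inr ⟨h.2, h.1⟩
        · exact Or.inl h
      obtain ⟨a, ha, ha0⟩ := intermediate_value_uIcc h.continuous.continuousOn h0
      exact hz a (ordConnected_Icc.uIcc_subset hy hxI ha) ha0
    have hint := intervalIntegral.integral_eq_sub_of_hasDerivAt (a := -(4 / 5)) (b := 4 / 5)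
      (fun x _ => h.hasDerivAt' x) (by
        have := h.continuous
        have := p.smooth.continuous
        exact Continuous.intervalIntegrable (by fun_prop) _ _)
    have hpos : 0 < ∫ y in (-(4 / 5) : ℝ)..4 / 5, p.k y ^ 2 * (ψ y * ψ x) := by
      refine intervalIntegral.integral_pos (by norm_num) ?_ (fun y hy => ?_) ⟨x, hxI, ?_⟩
      · have := h.continuous
        have := p.smooth.continuous
        exact Continuous.continuousOn (by fun_prop)
      · exact mul_nonneg (sq_nonneg _) (hsign y (Ioc_subset_Icc_self hy)).le
      · exact mul_pos (by positivity) (hsign x hxI)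
    rw [hr, neg_eq_zero.1 hl', sub_zero] at hint
    have e : ∫ y in (-(4 / 5) : ℝ)..4 / 5, -(ϑ ^ 2 / 4) * p.k y ^ 2 * ψ y =
        -(ϑ ^ 2 / 4) * ∫ y in (-(4 / 5) : ℝ)..4 / 5, p.k y ^ 2 * ψ y := by
      rw [← intervalIntegral.integral_const_mul]
      simp only [mul_assoc]
    rw [e] at hint
    have hϑ0 : -(ϑ ^ 2 / 4) ≠ 0 := by
      have := pow_pos hϑ.1 2
      linarith
    have h3 := (mul_eq_zero.1 hint).resolve_left hϑ0
    have e' : ∫ y in (-(4 / 5) : ℝ)..4 / 5, p.k y ^ 2 * (ψ y * ψ x) =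
        (∫ y in (-(4 / 5) : ℝ)..4 / 5, p.k y ^ 2 * ψ y) * ψ x := by
      rw [← intervalIntegral.integral_mul_const]
      simp only [mul_assoc]
    rw [e', h3, zero_mul] at hpos
    exact lt_irrefl _ hpos

/-! ### Resolvents of Schrödinger operators from a priori bounds -/

/-- Multiplication by a bounded function as a bounded operator. -/
theorem exists_mulL2_clm (V : ℝ → ℝ) (hV : MemLp V ∞ (volume : Measure ℝ)) :
    ∃ M : L2 →L[ℂ] L2, ∀ f, M f = mulL2 V hV f := by
  refine ⟨(mulL2 V hV).mkContinuous (eLpNormEssSup V volume).toReal fun f => ?_, fun f => rfl⟩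
  apply Lp.norm_le_mul_norm_of_ae_le_mul
  have hfin : eLpNormEssSup V volume ≠ ⊤ := by
    have := hV.eLpNorm_ne_top
    rwa [eLpNorm_exponent_top] at this
  filter_upwards [MemLp.coeFn_toLp
      ((Lp.memLp f).smul hV : MemLp (V • (f : ℝ → ℂ)) 2 volume),
    enorm_ae_le_eLpNormEssSup V volume] with x h1 h2
  have e : (mulL2 V hV f : ℝ → ℂ) x = V x • f x := h1
  rw [e, norm_smul]
  gcongr
  rw [← toReal_enorm]
  exact ENNReal.toReal_mono hfin h2

theorem coe_mulL2 (V : ℝ → ℝ) (hV : MemLp V ∞ (volume : Measure ℝ)) (f : L2) :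
    (mulL2 V hV f : ℝ → ℂ) =ᵐ[volume] fun x => V x • f x :=
  MemLp.coeFn_toLp ((Lp.memLp f).smul hV : MemLp (V • (f : ℝ → ℂ)) 2 volume)

theorem inner_mulL2 (V : ℝ → ℝ) (hV : MemLp V ∞ (volume : Measure ℝ)) (f g : L2) :
    inner ℂ (mulL2 V hV f) g = inner ℂ f (mulL2 V hV g) := by
  rw [L2.inner_def, L2.inner_def]
  apply integral_congr_ae
  filter_upwards [coe_mulL2 V hV f, coe_mulL2 V hV g] with x h1 h2
  rw [h1, h2, RCLike.inner_apply, RCLike.inner_apply, Complex.real_smul, Complex.real_smul,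
    map_mul, Complex.conj_ofReal]
  ring

/-- Symmetry of the second derivative on `H²(ℝ)`. -/
theorem inner_second_symm {a g h a' g' h' : L2} (h1 : IsWeakDeriv univ a g)
    (h2 : IsWeakDeriv univ g h) (h1' : IsWeakDeriv univ a' g') (h2' : IsWeakDeriv univ g' h') :
    inner ℂ a h' = inner ℂ h a' := by
  have e1 := h1.inner_add_inner h2'
  have e2 := h2.inner_add_inner h1'
  linear_combination e1 - e2

/-- Existence of the resolvent of a Schrödinger operator from an a priori bound. -/
theorem schrodinger_exists_resolvent (V : ℝ → ℝ) (hV : MemLp V ∞ (volume : Measure ℝ)) {κ : ℂ}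
    (hκ : κ.im ≠ 0) {C : ℝ}
    (hb : ∀ u : (schrodinger V hV).domain, ‖(u : L2)‖ ≤
      C * ‖schrodinger V hV u - (κ ^ 2 / 2) • (u : L2)‖)
    (hb' : ∀ u : (schrodinger V hV).domain,
      schrodinger V hV u - ((-starRingEnd ℂ κ) ^ 2 / 2) • (u : L2) = 0 → (u : L2) = 0) :
    ∃ R, IsResolventAt (schrodinger V hV) (κ ^ 2 / 2) R := by
  obtain ⟨M, hM⟩ := exists_mulL2_clm V hV
  have key : ∀ {μ : ℂ} {R G : L2 →L[ℂ] L2}, (∀ f, IsWeakDeriv univ (R f) (G f) ∧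
      IsWeakDeriv univ (G f) (-(μ ^ 2) • R f - (2 : ℂ) • f)) → ∀ f,
      ∃ h : R f ∈ (schrodinger V hV).domain,
        schrodinger V hV ⟨R f, h⟩ - (μ ^ 2 / 2) • R f = f + M (R f) := by
    intro μ R G h f
    refine ⟨⟨_, _, h f⟩, ?_⟩
    rw [schrodinger_apply V hV _ (h f).1 (h f).2, hM]
    module
  obtain ⟨R, G, hR⟩ := exists_freeResolvent κ hκ
  -- Since $(-\bar\kappa)^2=\overline{\kappa^2}$, this free resolvent is the adjoint of `R`.
  obtain ⟨R', G', hR'⟩ := exists_freeResolvent (-starRingEnd ℂ κ) (by simpa using hκ)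
  have hsymm : ∀ g s, inner ℂ (R g) s = inner ℂ g (R' s) := by
    intro g s
    have e := inner_second_symm (hR g).1 (hR g).2 (hR' s).1 (hR' s).2
    rw [inner_sub_left, inner_sub_right, inner_smul_left, inner_smul_left, inner_smul_right,
      inner_smul_right] at e
    simp only [map_neg, map_pow, map_ofNat, even_two.neg_pow] at e
    linear_combination (-1 / 2 : ℂ) * e
  -- On the range of `R`, the operator minus $\kappa^2/2$ acts as $1+MR$, so the resolvent is
  -- $R(1+MR)^{-1}$. The a priori bound makes $1+MR$ bounded below. A vector $h$ orthogonal to its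
  -- range satisfies $h=-R'Mh$, which puts it in the kernel of the problem at the conjugate energy.
  obtain ⟨S, hS⟩ := exists_rightInverse (ContinuousLinearMap.id ℂ L2 + M.comp R)
    (1 + ‖M‖ * |C|) (fun g => by
      obtain ⟨h, e⟩ := key hR g
      have h1 := hb ⟨R g, h⟩
      rw [e] at h1
      have eT : (ContinuousLinearMap.id ℂ L2 + M.comp R) g = g + M (R g) := rfl
      rw [eT]
      have h2 : ‖R g‖ ≤ |C| * ‖g + M (R g)‖ :=
        h1.trans (mul_le_mul_of_nonneg_right (le_abs_self C) (norm_nonneg _))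
      calc ‖g‖ = ‖(g + M (R g)) - M (R g)‖ := by rw [add_sub_cancel_right]
        _ ≤ ‖g + M (R g)‖ + ‖M (R g)‖ := norm_sub_le _ _
        _ ≤ ‖g + M (R g)‖ + ‖M‖ * (|C| * ‖g + M (R g)‖) := by
          gcongr
          exact (M.le_opNorm _).trans (by gcongr)
        _ = _ := by ring) (fun h hh => by
      have h1 : h + R' (M h) = 0 := by
        apply ext_inner_left ℂ
        intro g
        rw [inner_zero_right, inner_add_right, ← hsymm, hM, ← inner_mulL2, ← hM, ← inner_add_left]
        exact hh g
      obtain ⟨hd, e⟩ := key hR' (M h)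
      have h2 : R' (M h) = -h := (neg_eq_of_add_eq_zero_right h1).symm
      have h3 : M h + M (R' (M h)) = 0 := by rw [h2, map_neg, add_neg_cancel]
      have h4 : R' (M h) = 0 := hb' ⟨_, hd⟩ (e.trans h3)
      rw [h4, zero_eq_neg] at h2
      exact h2)
  have hres : ∀ f, ∃ h : (R.comp S) f ∈ (schrodinger V hV).domain,
      schrodinger V hV ⟨(R.comp S) f, h⟩ - (κ ^ 2 / 2) • (R.comp S) f = f := by
    intro f
    obtain ⟨h, e⟩ := key hR (S f)
    exact ⟨h, e.trans (hS f)⟩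
  refine ⟨R.comp S, hres, fun u => ?_⟩
  obtain ⟨hd, he⟩ := hres (schrodinger V hV u - (κ ^ 2 / 2) • (u : L2))
  set v : (schrodinger V hV).domain := ⟨_, hd⟩ with hv
  have hvc : (v : L2) = (R.comp S) (schrodinger V hV u - (κ ^ 2 / 2) • (u : L2)) := rfl
  have h0 := hb (v - u)
  have h1 : schrodinger V hV (v - u) - (κ ^ 2 / 2) • ((v - u : (schrodinger V hV).domain) : L2)
      = 0 := by
    rw [LinearPMap.map_sub, Submodule.coe_sub, smul_sub, hvc]
    rw [sub_eq_iff_eq_add] at he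
    rw [he]
    abel
  rw [h1, norm_zero, mul_zero, norm_le_zero_iff, Submodule.coe_sub, sub_eq_zero] at h0
  exact h0

/-! ### The a priori estimate on the support of the potential -/

/-- A zero-energy solution, rescaled, as a complex primitive. -/
theorem IsZeroSol.isPrimitive_scaled {l : ℝ} {q P P' : ℝ → ℝ} (h : IsZeroSol l q P P')
    (hq : Continuous q) (δ : ℝ) :
    IsPrimitive (fun x => ((P (x / δ) : ℝ) : ℂ)) (fun x => ((P' (x / δ) / δ : ℝ) : ℂ)) ∧
      IsPrimitive (fun x => ((P' (x / δ) / δ : ℝ) : ℂ))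
        (fun x => ((-l * q (x / δ) * P (x / δ) / δ ^ 2 : ℝ) : ℂ)) := by
  have h1 := h.continuous
  have h2 := h.continuous'
  have hd : ∀ x, HasDerivAt (fun x : ℝ => x / δ) (1 / δ) x := fun x =>
    (hasDerivAt_id x).div_const δ
  constructor
  · have : IsPrimitive (fun x => P (x / δ)) (fun x => P' (x / δ) / δ) :=
      IsPrimitive.of_hasDerivAt (fun x => ((h.hasDerivAt (x / δ)).comp x (hd x)).congr_deriv
        (by ring)) (by fun_prop)
    exact this.clm Complex.ofRealCLM
  · have : IsPrimitive (fun x => P' (x / δ) / δ)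
        (fun x => -l * q (x / δ) * P (x / δ) / δ ^ 2) :=
      IsPrimitive.of_hasDerivAt (fun x => (((h.hasDerivAt' (x / δ)).comp x
        (hd x)).div_const δ).congr_deriv (by ring)) (by fun_prop)
    exact this.clm Complex.ofRealCLM

/-- Pairing a solution with a rescaled zero-energy solution on `[-δ, δ]`. -/
theorem norm_wronskian_le {κ : ℂ} {l δ M A : ℝ} {q P P' : ℝ → ℝ} {F F' : ℝ → ℂ} {f g h : L2}
    (hP : IsZeroSol l q P P') (hq : Continuous q) (hδ : 0 < δ) (hδ1 : δ ≤ 1)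
    (hF : IsPrimitive F g) (hF' : IsPrimitive F' h) (hg : (g : ℝ → ℂ) =ᵐ[volume] F')
    (hh : ∀ᵐ x, h x = -κ ^ 2 * F x - 2 * f x - ((l * q (x / δ) / δ ^ 2 : ℝ) : ℂ) * F x)
    (hM : ∀ x ∈ Icc (-δ) δ, ‖F x‖ ≤ M) (hA : ∀ y ∈ Icc (-1 : ℝ) 1, |P y| ≤ A) {e x : ℝ}
    (he : e ∈ Icc (-δ) δ) (hx : x ∈ Icc (-δ) δ) (hPe : P (e / δ) = 1) (hPe' : P' (e / δ) = 0) :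
    ‖F' x * P (x / δ) - F x * (P' (x / δ) / δ : ℝ)‖ ≤
      ‖F' e‖ + A * (2 * ‖κ‖ ^ 2 * M + 4 * ‖f‖) := by
  obtain ⟨p1, p2⟩ := hP.isPrimitive_scaled hq δ
  have hA0 : 0 ≤ A := (abs_nonneg _).trans (hA 0 (by norm_num))
  have hM0 : 0 ≤ M := (norm_nonneg _).trans (hM x hx)
  have hm := (hF'.mul p1).sub (hF.mul p2)
  -- The rescaled zero-energy solution sees the same potential, so the terms of size $\delta^{-2}$
  -- cancel and the Wronskian has derivative $-P(\kappa^2F+2f)$.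
  have hm' := hm.congr_ae (g := fun x => -(P (x / δ) : ℂ) * (κ ^ 2 * F x + 2 * f x)) (by
    filter_upwards [hg, hh] with x h1 h2
    rw [h1, h2]
    push_cast
    ring)
  -- At the end point `e` one has $P=1$ and $P'=0$, so the Wronskian there is just $F'(e)$.
  have key := hm'.sub_eq e x
  simp only [hPe, hPe', zero_div, Complex.ofReal_zero, mul_zero, Complex.ofReal_one, mul_one,
    sub_zero] at key
  have hsub : uIoc e x ⊆ Ioc (-δ) δ := by
    intro t ht
    exact ⟨(le_min he.1 hx.1).trans_lt ht.1, ht.2.trans (max_le he.2 hx.2)⟩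
  have hbound : ∀ t ∈ Ioc (-δ) δ, ‖-(P (t / δ) : ℂ) * (κ ^ 2 * F t + 2 * f t)‖ ≤
      A * (‖κ‖ ^ 2 * M + 2 * ‖f t‖) := by
    intro t ht
    rw [norm_mul, norm_neg, Complex.norm_real]
    have h1 : ‖P (t / δ)‖ ≤ A := hA _ ⟨by rw [le_div_iff₀ hδ]; linarith [ht.1],
      by rw [div_le_iff₀ hδ]; linarith [ht.2]⟩
    refine mul_le_mul h1 ?_ (norm_nonneg _) hA0
    refine (norm_add_le _ _).trans ?_
    rw [norm_mul, norm_mul, norm_pow, Complex.norm_ofNat]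
    gcongr
    exact hM t ⟨ht.1.le, ht.2⟩
  have hfi : IntegrableOn (fun t => ‖f t‖) (Ioc (-δ) δ) :=
    (((locallyIntegrable_coe f).integrableOn_isCompact isCompact_Icc).mono_set
      Ioc_subset_Icc_self).norm
  have hci : IntegrableOn (fun _ : ℝ => ‖κ‖ ^ 2 * M) (Ioc (-δ) δ) := integrableOn_const (by simp)
  have hbi : IntegrableOn (fun t => A * (‖κ‖ ^ 2 * M + 2 * ‖f t‖)) (Ioc (-δ) δ) :=
    (hci.add (hfi.const_mul 2)).const_mul A
  have hint : ‖∫ t in e..x, -(P (t / δ) : ℂ) * (κ ^ 2 * F t + 2 * f t)‖ ≤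
      A * (2 * ‖κ‖ ^ 2 * M + 4 * ‖f‖) := by
    refine intervalIntegral.norm_integral_le_integral_norm_uIoc.trans ?_
    calc _ ≤ ∫ t in uIoc e x, A * (‖κ‖ ^ 2 * M + 2 * ‖f t‖) := by
          refine setIntegral_mono_on ?_ (hbi.mono_set hsub) measurableSet_uIoc
            fun t ht => hbound t (hsub ht)
          exact (intervalIntegrable_iff.1 (hm'.intervalIntegrable e x)).norm
      _ ≤ ∫ t in Ioc (-δ) δ, A * (‖κ‖ ^ 2 * M + 2 * ‖f t‖) := by
          refine setIntegral_mono_set hbi (Eventually.of_forall fun t => ?_)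
            hsub.eventuallyLE
          simp only [Pi.zero_apply]
          positivity
      _ = A * (2 * δ * (‖κ‖ ^ 2 * M) + 2 * ∫ t in Ioc (-δ) δ, ‖f t‖) := by
          have e1 : ∫ t in Ioc (-δ) δ, 2 * ‖f t‖ = 2 * ∫ t in Ioc (-δ) δ, ‖f t‖ :=
            integral_const_mul _ _
          rw [integral_const_mul, integral_add hci (hfi.const_mul 2), e1, setIntegral_const]
          congr 2
          simp only [smul_eq_mul, Measure.real, Real.volume_Ioc]
          rw [ENNReal.toReal_ofReal (by linarith)]
          ring
      _ ≤ A * (2 * ‖κ‖ ^ 2 * M + 4 * ‖f‖) := by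
          have h1 := integral_norm_Ioc_le f (show -δ ≤ δ by linarith)
          have h2 : √(δ - -δ) ≤ 2 := by
            rw [Real.sqrt_le_left (by norm_num)]; linarith
          have h3 : 2 * δ * (‖κ‖ ^ 2 * M) ≤ 2 * ‖κ‖ ^ 2 * M := by
            have : 0 ≤ ‖κ‖ ^ 2 * M := by positivity
            nlinarith
          have h4 := mul_le_mul_of_nonneg_right h2 (norm_nonneg f)
          refine mul_le_mul_of_nonneg_left ?_ hA0
          linarith
  rw [← key] at hint
  have := norm_le_norm_add_norm_sub' (F' x * P (x / δ) - F x * (P' (x / δ) / δ : ℝ)) (F' e)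
  linarith

namespace CurvatureProfile

variable (p : CurvatureProfile)

/-- Away from resonances there are zero-energy solutions equal to `1` on the right and on the
left, and they are linearly independent. -/
theorem exists_independent_sols {ϑ : ℝ} (h : ¬ ZeroEnergyResonance p ϑ) :
    ∃ (P P' Q Q' : ℝ → ℝ) (ρ A : ℝ),
      IsZeroSol (ϑ ^ 2 / 4) (fun x => p.k x ^ 2) P P' ∧
      IsZeroSol (ϑ ^ 2 / 4) (fun x => p.k x ^ 2) Q Q' ∧ P 1 = 1 ∧ P' 1 = 0 ∧ Q (-1) = 1 ∧
      Q' (-1) = 0 ∧ ρ ≠ 0 ∧ (∀ x, P' x * Q x - P x * Q' x = ρ) ∧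
      ∀ x ∈ Icc (-1 : ℝ) 1, |P x| ≤ A ∧ |Q x| ≤ A := by
  obtain ⟨B, hB⟩ := p.exists_bound
  obtain ⟨W, W', -, h2, h3, h4⟩ := exists_zeroEnergySol (q := fun x => p.k x ^ 2)
    (p.smooth.continuous.pow 2) hB (fun x hx => by
      simp only [p.k_eq_zero (hx.trans (le_abs_self x))]; norm_num)
  -- The solution normalized on the left is the reflection of the right-normalized one for the
  -- reflected profile.
  obtain ⟨Z, Z', -, h2', h3', h4'⟩ := exists_zeroEnergySol (q := fun x => p.k (-x) ^ 2)
    ((p.smooth.continuous.comp continuous_neg).pow 2) (fun x => hB (-x)) (fun x hx => by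
      simp only [p.k_eq_zero (hx.trans ((le_abs_self x).trans (abs_neg x).symm.le))]; norm_num)
  set l := ϑ ^ 2 / 4
  have hP : IsZeroSol l (fun x => p.k x ^ 2) (W l) (W' l) := ⟨h2 l, h3 l⟩
  have hQ : IsZeroSol l (fun x => p.k x ^ 2) (fun x => Z l (-x)) (fun x => -Z' l (-x)) := by
    have : IsZeroSol l (fun x => p.k (-x) ^ 2) (Z l) (Z' l) := ⟨h2' l, h3' l⟩
    simpa using this.comp_neg
  obtain ⟨A₁, hA₁⟩ := isCompact_Icc.exists_bound_of_continuousOn (s := Icc (-1 : ℝ) 1)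
    hP.continuous.continuousOn
  obtain ⟨A₂, hA₂⟩ := isCompact_Icc.exists_bound_of_continuousOn (s := Icc (-1 : ℝ) 1)
    hQ.continuous.continuousOn
  have hconst : ∀ x, W' l x * Z l (-x) - W l x * -Z' l (-x) =
      W' l (-1) * Z l (- -1) - W l (-1) * -Z' l (- -1) := fun x =>
    is_const_of_deriv_eq_zero (fun x => (hP.hasDerivAt_wronskian hQ x).differentiableAt)
      (fun x => by rw [(hP.hasDerivAt_wronskian hQ x).deriv]; ring) x (-1)
  refine ⟨W l, W' l, _, _, _, max A₁ A₂, hP, hQ, (h4 l 1 le_rfl).1, (h4 l 1 le_rfl).2, ?_, ?_, ?_,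
    hconst, fun x hx => ⟨(hA₁ x hx).trans (le_max_left _ _), (hA₂ x hx).trans (le_max_right _ _)⟩⟩
  · rw [neg_neg]; exact (h4' l 1 le_rfl).1
  · rw [neg_neg, (h4' l 1 le_rfl).2, neg_zero]
  · intro h0
    apply h
    -- By the normalization at $-1$ the Wronskian equals $W_l'(-1)$. If it vanishes, $W_l$ is
    -- constant on both sides of the support, hence bounded, which is a resonance.
    have hW0 : W' l (-1) = 0 := by
      simpa [(h4' l 1 le_rfl).1, (h4' l 1 le_rfl).2] using h0
    refine (p.resonance_iff ϑ).2 ⟨W l, W' l, hP, ⟨1, by rw [(h4 l 1 le_rfl).1]; norm_num⟩,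
      max (max A₁ 1) |W l (-1)|, fun s => ?_⟩
    rcases le_total 1 s with hs | hs
    · rw [(h4 l s hs).1, abs_one]
      exact (le_max_right A₁ 1).trans (le_max_left _ _)
    · rcases le_total (-1) s with hs' | hs'
      · exact (hA₁ s ⟨hs', hs⟩).trans ((le_max_left A₁ 1).trans (le_max_left _ _))
      · have hd : ∀ t, t ≤ -1 → W' l t = 0 := by
          intro t ht
          have := hP.comp_neg.eqOn_deriv (a := 1) (fun x hx => by
            rw [p.k_eq_zero (hx.trans ((le_abs_self x).trans (abs_neg x).symm.le))]; norm_num)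
            (x := -t) (by linarith)
          simpa [hW0] using this
        have hc := intervalIntegral.integral_eq_sub_of_hasDerivAt (a := s) (b := -1)
          (f := W l) (f' := fun _ => 0) (fun t ht => by
            rw [uIcc_of_le hs'] at ht
            rw [← hd t ht.2]
            exact hP.hasDerivAt t) (by simp)
        rw [intervalIntegral.integral_zero] at hc
        rw [show W l s = W l (-1) by linarith]
        exact le_max_right _ _

end CurvatureProfile

namespace CurvatureProfile

variable (p : CurvatureProfile)

/-- Representatives of a function in the domain of the operator and of its derivative. -/
theorem exists_representatives (ϑ δ : ℝ) (w : ℂ) (u : (curvatureOp p ϑ δ).domain) (f : L2)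
    (hf : curvatureOp p ϑ δ u - w • (u : L2) = f) :
    ∃ (F F' : ℝ → ℂ) (g h : L2), IsPrimitive F g ∧ IsPrimitive F' h ∧
      ((u : L2) : ℝ → ℂ) =ᵐ[volume] F ∧ (g : ℝ → ℂ) =ᵐ[volume] F' ∧
      ∀ᵐ x, h x = -(2 * w) * F x - 2 * f x -
        ((ϑ ^ 2 / 4 * p.k (x / δ) ^ 2 / δ ^ 2 : ℝ) : ℂ) * F x := by
  obtain ⟨g, h, hg, hh⟩ := u.2
  obtain ⟨F, hF, huF⟩ := hg.exists_isPrimitive_univ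
  obtain ⟨F', hF', hgF⟩ := hh.exists_isPrimitive_univ
  refine ⟨F, F', g, h, hF, hF', huF, hgF, ?_⟩
  have e : (-(1 / 2) : ℂ) • h + mulL2 _ (p.memLp_potential ϑ δ) u - w • (u : L2) = f := by
    rw [← hf]
    exact congrArg (· - w • (u : L2)) (schrodinger_apply _ (p.memLp_potential ϑ δ) u hg hh).symm
  filter_upwards [huF, coe_mulL2 _ (p.memLp_potential ϑ δ) u,
    Lp.coeFn_sub ((-(1 / 2) : ℂ) • h + mulL2 _ (p.memLp_potential ϑ δ) u) (w • (u : L2)),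
    Lp.coeFn_add ((-(1 / 2) : ℂ) • h) (mulL2 _ (p.memLp_potential ϑ δ) u),
    Lp.coeFn_smul (-(1 / 2) : ℂ) h, Lp.coeFn_smul w (u : L2)] with x h1 h2 h3 h4 h5 h6
  rw [e, Pi.sub_apply, h4, Pi.add_apply, h5, h2, h6, Pi.smul_apply, Pi.smul_apply, h1,
    Complex.real_smul, smul_eq_mul, smul_eq_mul, CurvatureProfile.scaled] at h3
  push_cast at h3 ⊢
  linear_combination 2 * h3

/-- The a priori estimate: solutions are of size `O(δ)` on the support of the potential. -/
theorem exists_apriori {ϑ : ℝ} (hres : ¬ ZeroEnergyResonance p ϑ) {κ : ℂ} (hκ : 0 < κ.im) :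
    ∃ A δ₀ : ℝ, 0 ≤ A ∧ 0 < δ₀ ∧ δ₀ ≤ 1 ∧ ∀ δ, 0 < δ → δ < δ₀ →
      ∀ (u : (curvatureOp p ϑ δ).domain) (f : L2),
        curvatureOp p ϑ δ u - (κ ^ 2 / 2) • (u : L2) = f →
        ∃ F : ℝ → ℂ, ((u : L2) : ℝ → ℂ) =ᵐ[volume] F ∧
          (∀ x ∈ Icc (-δ) δ, ‖F x‖ ≤ A * δ * ‖f‖) ∧ (∃ F', IsHalfLineSol κ f F F' δ) ∧
          ∃ F', IsHalfLineSol κ (fun x => f (-x)) (fun x => F (-x)) F' δ := by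
  obtain ⟨P, P', Q, Q', ρ, A₀, hP, hQ, hP1, hP1', hQ1, hQ1', hρ, hwr, hA⟩ :=
    p.exists_independent_sols hres
  have hA0 : 0 ≤ A₀ := (abs_nonneg _).trans (hA 0 (by norm_num)).1
  have hρ0 : 0 < |ρ| := abs_pos.2 hρ
  set cN := 2 * Real.exp κ.im * (eLpNorm (expAbs κ) 2 volume).toReal with hcN
  have hcN0 : 0 ≤ cN := by positivity
  set a := ‖κ‖ + 2 * A₀ * ‖κ‖ ^ 2 with ha
  have ha0 : 0 ≤ a := by positivity
  set b := cN + 4 * A₀ with hb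
  have hb0 : 0 ≤ b := by positivity
  set K := 2 * A₀ / |ρ| with hK
  have hK0 : 0 ≤ K := by positivity
  -- The estimate to come is $M\le\delta K(aM+b\|f\|)$; the bound on $\delta$ gives $\delta
  -- Ka\le\frac12$, so that the term in $M$ can be absorbed.
  refine ⟨2 * K * b, min 1 (1 / (2 * K * a + 1)), by positivity, by positivity, min_le_left _ _,
    fun δ hδ hδ₀ u f hf => ?_⟩
  have hδ1 : δ ≤ 1 := hδ₀.le.trans (min_le_left _ _)
  have hδK : δ * K * a ≤ 1 / 2 := by
    have h1 := hδ₀.trans_le (min_le_right _ _)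
    have h2 : 0 ≤ K * a := by positivity
    rw [lt_div_iff₀ (by positivity)] at h1
    nlinarith
  obtain ⟨F, F', g, h, hF, hF', huF, hgF, hh⟩ := p.exists_representatives ϑ δ _ u f hf
  have hh' : ∀ᵐ x, h x = -κ ^ 2 * F x - 2 * f x -
      ((ϑ ^ 2 / 4 * p.k (x / δ) ^ 2 / δ ^ 2 : ℝ) : ℂ) * F x := by
    filter_upwards [hh] with x hx
    rw [hx]
    ring
  have hout : ∀ᵐ x, δ ≤ |x| → h x = -κ ^ 2 * F x - 2 * f x := by
    filter_upwards [hh'] with x hx hxδ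
    have : p.k (x / δ) = 0 := by
      apply p.k_eq_zero
      rw [abs_div, abs_of_pos hδ, le_div_iff₀ hδ]
      linarith
    rw [hx, this]
    simp
  have sr : IsHalfLineSol κ f F F' δ := by
    apply isHalfLineSol_of_isPrimitive (u := u) hF hF'
    · filter_upwards [huF] with x hx _ using hx
    · filter_upwards [hgF] with x hx _ using hx
    · filter_upwards [hout] with x hx hxδ using hx (hxδ.le.trans (le_abs_self x))
  have sl : IsHalfLineSol κ (fun x => f (-x)) (fun x => F (-x)) (fun x => -F' (-x)) δ := by
    apply isHalfLineSol_comp_neg (u := u) hF hF'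
    · filter_upwards [huF] with x hx _ using hx
    · filter_upwards [hgF] with x hx _ using hx
    · filter_upwards [hout] with x hx hxδ using hx (by
        rw [abs_of_neg (by linarith)]; linarith)
  refine ⟨F, huF, ?_, ⟨F', sr⟩, ⟨_, sl⟩⟩
  obtain ⟨x₀, hx₀, hmax⟩ := isCompact_Icc.exists_isMaxOn
    (nonempty_Icc.2 (show -δ ≤ δ by linarith)) hF.continuous.norm.continuousOn
  set M := ‖F x₀‖ with hM
  have hM0 : 0 ≤ M := norm_nonneg _
  have hMb : ∀ x ∈ Icc (-δ) δ, ‖F x‖ ≤ M := fun x hx => hmax hx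
  have hexp : Real.exp (κ.im * δ) ≤ Real.exp κ.im := Real.exp_le_exp.2 (by nlinarith)
  -- The half-line estimate controls only $F'-i\kappa F$ at the end points; the remaining $\kappa F$
  -- is paid for with $M$.
  have hend : ∀ {c : ℂ} {y N : ℝ}, ‖c - Complex.I * κ * F y‖ ≤
      2 * Real.exp (κ.im * δ) * (eLpNorm (expAbs κ) 2 volume).toReal * N → 0 ≤ N → ‖F y‖ ≤ M →
      ‖c‖ ≤ cN * N + ‖κ‖ * M := by
    intro c y N h1 hN h2
    have h3 := norm_le_norm_add_norm_sub' c (Complex.I * κ * F y)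
    rw [norm_mul, norm_mul, Complex.norm_I, one_mul] at h3
    have h4 : 2 * Real.exp (κ.im * δ) * (eLpNorm (expAbs κ) 2 volume).toReal * N ≤ cN * N := by
      rw [hcN]; gcongr
    have h5 := mul_le_mul_of_nonneg_left h2 (norm_nonneg κ)
    linarith
  have hδmem : δ ∈ Icc (-δ) δ := ⟨by linarith, le_rfl⟩
  have hδmem' : -δ ∈ Icc (-δ) δ := ⟨le_rfl, by linarith⟩
  have er : ‖F' δ‖ ≤ cN * ‖f‖ + ‖κ‖ * M := by
    have := sr.norm_deriv_sub_le hκ hδ.le (Lp.memLp f)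
    rw [← Lp.norm_def] at this
    exact hend this (norm_nonneg f) (hMb δ hδmem)
  have el : ‖F' (-δ)‖ ≤ cN * ‖f‖ + ‖κ‖ * M := by
    have := sl.norm_deriv_sub_le hκ hδ.le (memLp_comp_neg f)
    rw [toReal_eLpNorm_comp_neg] at this
    rw [← norm_neg]
    exact hend this (norm_nonneg f) (hMb (-δ) hδmem')
  have hq : Continuous fun x => p.k x ^ 2 := p.smooth.continuous.pow 2
  have hdiv : δ / δ = 1 := div_self hδ.ne'
  have hmain : ∀ x ∈ Icc (-δ) δ, ‖F x‖ ≤ δ * K * (a * M + b * ‖f‖) := by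
    intro x hx
    have w1 := norm_wronskian_le hP hq hδ hδ1 hF hF' hgF hh' hMb (fun y hy => (hA y hy).1)
      hδmem hx (by rw [hdiv, hP1]) (by rw [hdiv, hP1'])
    have w2 := norm_wronskian_le hQ hq hδ hδ1 hF hF' hgF hh' hMb (fun y hy => (hA y hy).2)
      hδmem' hx (by rw [neg_div, hdiv, hQ1]) (by rw [neg_div, hdiv, hQ1'])
    have hxd : x / δ ∈ Icc (-1 : ℝ) 1 :=
      ⟨by rw [le_div_iff₀ hδ]; linarith [hx.1], by rw [div_le_iff₀ hδ]; linarith [hx.2]⟩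
    -- The combination of the two Wronskians that eliminates $F'$. The factor $1/\delta$ on the left
    -- is where the smallness of $F$ comes from.
    have hid : F x * ((ρ / δ : ℝ) : ℂ) =
        (F' x * Q (x / δ) - F x * (Q' (x / δ) / δ : ℝ)) * P (x / δ) -
        (F' x * P (x / δ) - F x * (P' (x / δ) / δ : ℝ)) * Q (x / δ) := by
      rw [← hwr (x / δ)]
      push_cast
      ring
    have hS : ‖F x‖ * (|ρ| / δ) ≤ (a * M + b * ‖f‖) * A₀ + (a * M + b * ‖f‖) * A₀ := by
      have h1 : ‖F x * ((ρ / δ : ℝ) : ℂ)‖ = ‖F x‖ * (|ρ| / δ) := by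
        rw [norm_mul, Complex.norm_real, Real.norm_eq_abs, abs_div, abs_of_pos hδ]
      rw [← h1, hid]
      refine (norm_sub_le _ _).trans (add_le_add ?_ ?_) <;> rw [norm_mul, Complex.norm_real]
      · refine mul_le_mul (w2.trans ?_) (hA _ hxd).1 (abs_nonneg _) (by positivity)
        rw [ha, hb]
        linarith
      · refine mul_le_mul (w1.trans ?_) (hA _ hxd).2 (abs_nonneg _) (by positivity)
        rw [ha, hb]
        linarith
    rw [← mul_div_assoc, div_le_iff₀ hδ] at hS
    have : δ * K * (a * M + b * ‖f‖) = ((a * M + b * ‖f‖) * A₀ + (a * M + b * ‖f‖) * A₀) * δ / |ρ| := by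
      rw [hK]; ring
    rw [this, le_div_iff₀ hρ0]
    exact hS
  intro x hx
  refine (hMb x hx).trans ?_
  have h1 := hmain x₀ hx₀
  have h2 : δ * K * a * M ≤ 1 / 2 * M := mul_le_mul_of_nonneg_right hδK hM0
  rw [← hM] at h1
  linarith

/-! ### Comparison with the Dirichlet resolvent and norm convergence -/

/-- Comparison with the Dirichlet resolvent. -/
theorem exists_comparison {ϑ : ℝ} (hres : ¬ ZeroEnergyResonance p ϑ) {κ z : ℂ} (hκ : 0 < κ.im)
    (hz : κ ^ 2 = 2 * z ^ 2) : ∃ (R : L2 →L[ℂ] L2) (C δ₀ : ℝ), 0 ≤ C ∧ 0 < δ₀ ∧ δ₀ ≤ 1 ∧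
      IsResolventAt dirichletOp (z ^ 2) R ∧ ∀ δ, 0 < δ → δ < δ₀ →
      ∀ (u : (curvatureOp p ϑ δ).domain) (f : L2),
        curvatureOp p ϑ δ u - (κ ^ 2 / 2) • (u : L2) = f → ‖(u : L2) - R f‖ ≤ C * √δ * ‖f‖ := by
  obtain ⟨A, δ₀, hA, hδ₀, hδ₀1, hap⟩ := p.exists_apriori hres hκ
  obtain ⟨R, B, hB, hR, hRrep⟩ := exists_dirichletResolvent hκ hz
  refine ⟨R, (A + B) * Real.exp κ.im * ‖expAbsL2 hκ‖, δ₀, by positivity, hδ₀, hδ₀1, hR,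
    fun δ hδ hδδ₀ u f hf => ?_⟩
  have hδ1 : δ ≤ 1 := hδδ₀.le.trans hδ₀1
  obtain ⟨F, huF, hFb, ⟨F', sr⟩, ⟨Fl', sl⟩⟩ := hap δ hδ hδδ₀ u f hf
  obtain ⟨G, -, hRG, hGb, ⟨G', tr⟩, ⟨Gl', tl⟩⟩ := hRrep f
  set m := (A + B) * √δ * ‖f‖ with hm
  have hm0 : 0 ≤ m := by positivity
  -- Both solutions are small here separately: $F$ is $O(\delta)$ by the a priori estimate, $G$ only
  -- $O(\sqrt\delta)$ by Hölder continuity at the origin.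
  have hin : ∀ x ∈ Icc (-δ) δ, ‖F x - G x‖ ≤ m := by
    intro x hx
    have h1 : δ ≤ √δ := by
      rw [Real.le_sqrt hδ.le hδ.le]
      nlinarith
    have h2 : √|x| ≤ √δ := Real.sqrt_le_sqrt (abs_le.2 hx)
    calc ‖F x - G x‖ ≤ ‖F x‖ + ‖G x‖ := norm_sub_le _ _
      _ ≤ A * √δ * ‖f‖ + B * √δ * ‖f‖ := by
        refine add_le_add ((hFb x hx).trans ?_) ((hGb x).trans ?_) <;> gcongr
      _ = m := by rw [hm]; ring
  -- The right-hand sides cancel, so beyond $\delta$ the difference is an exact decaying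
  -- exponential. The factor $e^{\Im\kappa}$ covers the shift of base point from $0$ to
  -- $\delta\le1$.
  have htail : ∀ {f₁ F₁ F₁' G₁ G₁' : ℝ → ℂ}, IsHalfLineSol κ f₁ F₁ F₁' δ →
      IsHalfLineSol κ f₁ G₁ G₁' 0 → ‖F₁ δ - G₁ δ‖ ≤ m → ∀ x, δ ≤ x →
      ‖F₁ x - G₁ x‖ ≤ m * Real.exp κ.im * ‖expAbs κ x‖ := by
    intro f₁ F₁ F₁' G₁ G₁' h1 h2 h3 x hx
    have hd := (h1.sub_const_mul (h2.mono hδ.le) 1).congr_rhs (f₁ := fun _ => 0)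
      (Eventually.of_forall fun x _ => by simp)
    have e := hd.eq_mul_exp hκ hδ.le hx
    simp only [one_mul] at e
    rw [e, norm_mul, mul_assoc m]
    refine mul_le_mul h3 ?_ (norm_nonneg _) hm0
    rw [norm_expAbs, ← Real.exp_add, Complex.norm_exp, abs_of_nonneg (hδ.le.trans hx)]
    refine Real.exp_le_exp.2 ?_
    have : (Complex.I * κ * ((x - δ : ℝ) : ℂ)).re = -κ.im * (x - δ) := by
      rw [Complex.re_mul_ofReal]; simp
    rw [this]
    nlinarith
  have hall : ∀ x, ‖F x - G x‖ ≤ m * Real.exp κ.im * ‖expAbs κ x‖ := by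
    intro x
    rcases le_or_gt δ x with h | h
    · exact htail sr tr (hin δ ⟨by linarith, le_rfl⟩) x h
    rcases le_or_gt x (-δ) with h' | h'
    · have := htail sl tl (hin (-δ) ⟨le_rfl, by linarith⟩) (-x) (by linarith)
      rwa [expAbs_neg, neg_neg] at this
    · refine (hin x ⟨h'.le, h.le⟩).trans ?_
      rw [mul_assoc]
      refine le_mul_of_one_le_right hm0 ?_
      rw [norm_expAbs, ← Real.exp_add]
      refine Real.one_le_exp ?_
      have : |x| ≤ 1 := (abs_le.2 ⟨h'.le, h.le⟩).trans hδ1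
      nlinarith
  have hfin : ‖(u : L2) - R f‖ ≤ m * Real.exp κ.im * ‖expAbsL2 hκ‖ := by
    apply Lp.norm_le_mul_norm_of_ae_le_mul
    filter_upwards [Lp.coeFn_sub (u : L2) (R f), huF, hRG, coe_expAbsL2 hκ] with x h1 h2 h3 h4
    rw [h1, Pi.sub_apply, h2, h3, h4]
    exact hall x
  refine hfin.trans (le_of_eq ?_)
  rw [hm]
  ring

/-- The resolvents exist for small `δ` and converge in norm. -/
theorem exists_resolvent_sub_le {ϑ : ℝ} (hres : ¬ ZeroEnergyResonance p ϑ) {z : ℂ}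
    (hz : 0 < z.im) : ∃ (R : L2 →L[ℂ] L2) (C δ₀ : ℝ), 0 < δ₀ ∧
      IsResolventAt dirichletOp (z ^ 2) R ∧ ∀ δ, 0 < δ → δ < δ₀ →
      ∃ S, IsResolventAt (curvatureOp p ϑ δ) (z ^ 2) S ∧ ‖S - R‖ ≤ C * √δ := by
  have h2 : ((√2 : ℝ) : ℂ) ^ 2 = 2 := by
    rw [← Complex.ofReal_pow, Real.sq_sqrt (by norm_num)]; norm_num
  -- The factor $\sqrt2$ accounts for the $\frac12$ in front of the second derivative:
  -- $\kappa^2/2=z^2$.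
  set κ : ℂ := (√2 : ℝ) * z with hκdef
  have hκ : 0 < κ.im := by
    rw [hκdef, Complex.im_ofReal_mul]
    positivity
  have hκz : κ ^ 2 = 2 * z ^ 2 := by rw [hκdef, mul_pow, h2]
  have hκ' : 0 < (-starRingEnd ℂ κ).im := by simpa using hκ
  have hκz' : (-starRingEnd ℂ κ) ^ 2 = 2 * (starRingEnd ℂ z) ^ 2 := by
    rw [even_two.neg_pow, ← map_pow, hκz, map_mul, map_pow, map_ofNat]
  have hw : κ ^ 2 / 2 = z ^ 2 := by rw [hκz]; ring
  obtain ⟨R, C, δ₁, hC, hδ₁, hδ₁1, hR, hcmp⟩ := p.exists_comparison hres hκ hκz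
  -- The point $-\bar\kappa$ is again in the upper half-plane and belongs to the energy $\bar z^2$;
  -- this comparison supplies the injectivity needed for dense range.
  obtain ⟨R', C', δ₂, hC', hδ₂, hδ₂1, hR', hcmp'⟩ := p.exists_comparison hres hκ' hκz'
  refine ⟨R, C, min δ₁ δ₂, lt_min hδ₁ hδ₂, hR, fun δ hδ hδ₀ => ?_⟩
  have hb := hcmp δ hδ (hδ₀.trans_le (min_le_left _ _))
  have hb' := hcmp' δ hδ (hδ₀.trans_le (min_le_right _ _))
  obtain ⟨S, hS⟩ := schrodinger_exists_resolvent _ (p.memLp_potential ϑ δ) hκ.ne'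
    (C := ‖R‖ + C * √δ) (fun u => by
      have h1 := hb u _ rfl
      have h3 := norm_le_norm_add_norm_sub' (u : L2)
        (R (curvatureOp p ϑ δ u - (κ ^ 2 / 2) • (u : L2)))
      have h4 := R.le_opNorm (curvatureOp p ϑ δ u - (κ ^ 2 / 2) • (u : L2))
      rw [add_mul]
      exact h3.trans (add_le_add h4 h1)) (fun u hu => by
      have h1 := hb' u 0 hu
      rwa [map_zero, norm_zero, mul_zero, sub_zero, norm_le_zero_iff] at h1)
  refine ⟨S, by rw [← hw]; exact hS, ContinuousLinearMap.opNorm_le_bound _ (by positivity)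
    fun f => ?_⟩
  obtain ⟨h, e⟩ := hS.1 f
  exact hb ⟨S f, h⟩ f e

end CurvatureProfile

end SoftGraph

theorem mainTheorem1 (p : SoftGraph.CurvatureProfile) :
    (∀ ϑ ∈ Ioo (0 : ℝ) Real.pi, ¬ SoftGraph.ZeroEnergyResonance p ϑ →
      ∀ δ : ℝ → ℝ, (∀ ε, 0 < ε → 0 < δ ε) → Tendsto δ (𝓝[>] 0) (𝓝 0) →
      ∀ z : ℂ, 0 < z.im →
        z ^ 2 ∈ SoftGraph.opResolventSet SoftGraph.dirichletOp ∧
        (∀ᶠ ε in 𝓝[>] (0 : ℝ),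
          z ^ 2 ∈ SoftGraph.opResolventSet (SoftGraph.curvatureOp p ϑ (δ ε))) ∧
        Tendsto (fun ε => SoftGraph.opResolvent (SoftGraph.curvatureOp p ϑ (δ ε)) (z ^ 2))
          (𝓝[>] (0 : ℝ)) (𝓝 (SoftGraph.opResolvent SoftGraph.dirichletOp (z ^ 2)))) ∧
    {ϑ : ℝ | ϑ ∈ Ioo (0 : ℝ) Real.pi ∧ SoftGraph.ZeroEnergyResonance p ϑ}.Finite ∧
    ((∀ s, |p.k s| ≤ 1) → (∀ s, 3 / 4 < |s| → p.k s = 0) →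
      ∀ ϑ ∈ Ioo (0 : ℝ) Real.pi, ¬ SoftGraph.ZeroEnergyResonance p ϑ) := by
  refine ⟨fun ϑ _ hres δ hδ hlim z hz => ?_, p.finite_resonances,
    fun h1 h2 ϑ hϑ => p.not_resonance h1 h2 hϑ⟩
  obtain ⟨R, C, δ₀, hδ₀, hR, hS⟩ := p.exists_resolvent_sub_le hres hz
  have hev : ∀ᶠ ε in 𝓝[>] (0 : ℝ), 0 < δ ε ∧ δ ε < δ₀ := by
    filter_upwards [self_mem_nhdsWithin, hlim.eventually (gt_mem_nhds hδ₀)] with ε h1 h2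
    exact ⟨hδ ε h1, h2⟩
  refine ⟨⟨R, hR⟩, ?_, ?_⟩
  · filter_upwards [hev] with ε hε
    obtain ⟨S, hS, -⟩ := hS (δ ε) hε.1 hε.2
    exact ⟨S, hS⟩
  · rw [SoftGraph.opResolvent_eq hR, tendsto_iff_norm_sub_tendsto_zero]
    have hlim' : Tendsto (fun ε => C * √(δ ε)) (𝓝[>] (0 : ℝ)) (𝓝 0) := by
      have := ((Real.continuous_sqrt.tendsto 0).comp hlim).const_mul C
      simpa using this
    refine squeeze_zero' (Eventually.of_forall fun ε => norm_nonneg _) ?_ hlim'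
    filter_upwards [hev] with ε hε
    obtain ⟨S, hS, hb⟩ := hS (δ ε) hε.1 hε.2
    rwa [SoftGraph.opResolvent_eq hS]
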